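/- Let $(M,g)$ be a smooth 3-dimensional Lorentzian manifold, and let $(V,\eta)$ be the model Lorentzian inner-product space with basis $(\boldsymbol\ell,\boldsymbol m,\boldsymbol n)$ such that $\eta(\boldsymbol\ell,\boldsymbol n)=-1$, $\eta(\boldsymbol m,\boldsymbol m)=\tfrac12$, all other products being zero. Let $O(\eta)$ be its automorphism group, $\mathcal R^p=\otimes^4V^*\oplus\cdots\oplus\otimes^{4+p}V^*$, let $O(\eta,M)$ be the bundle of $\eta$-orthogonal coframes, and let $\hat R^{(p)}:O(\eta,M)\to\mathcal R^p$ be the map given by the components of the Riemann tensor and its first $p$ covariant derivatives. Relative to a moving $\eta$-orthogonal coframe on an open set $U\subset M$, write $R^{(p)}=(R_{abcd},\dots,R_{abcd;e_1\dots e_p}):U\to\mathcal R^p$. $(M,g)$ is *fully regular* if $r_p=\operatorname{rank}\hat R^{(p)}$ is constant for every $p\ge 0$. Set $r_{-1}=0$ and let $q$ be the smallest integer with $r_{q-1}=r_q$; the *order* of $(M,g)$ is $q-1$. $(M,g)$ is *curvature regular* if for every $p\ge0$ there is a submanifold $S\subset\mathcal R^p$ (a $p$th order normalizing cross-section) and a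 subgroup $G_p\subset O(\eta)$ such that (i) $G_p$ fixes $S$ pointwise, (ii) $X\in O(\eta)$ and $X(S)\cap S\ne\emptyset$ imply $X\in G_p$, and (iii) $M$ is covered by the domains of moving $\eta$-orthogonal coframes for which $R^{(p)}$ takes values in $S$. Then put $s_p=\dim G_p$, and let $t_p$ be the rank of $R^{(p)}$ relative to such normalized moving coframes. $(M,g)$ is $\mathrm{CH}_0$ if it is curvature regular and $t_0=0$. A curvature regular $(M,g)$ has *$k$th-order pseudo-stabilization* ($k\ge1$) if $s_k=s_{k-1}>s_q$. The curvature is of *(Petrov) type N* if at every point there is a null triad $(\boldsymbol\ell,\boldsymbol m,\boldsymbol n)$ (a frame with the inner products above) relative to which the only non-zero component of the trace-free Ricci tensor $S_{ab}=R_{ab}-\tfrac13Rg_{ab}$ is $S(\boldsymbol n,\boldsymbol n)=\Psi_4=\pm1$. **Proposition.** Let $(M,g)$ be a fully regular, $\mathrm{CH}_0$, smooth 3-dimensional Lorentzian manifold whose curvature is of type N at every point, and suppose that it has $k$th-order pseudo-stabilization for some $k\ge1$ (for instance $k=1$). Then its order satisfies $q-1\le 3$. -/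

import Mathlib

open scoped Manifold ContDiff Matrix

noncomputable section

namespace CurvHom

/-! ### Tensors over a model inner-product space

The model space `V = ℝⁿ` carries the inner product with Gram matrix `η`.
A covariant tensor of rank `m` is given by its components `T_{a₁ … aₘ}`. -/

/-- Covariant rank `m` tensors on `ℝⁿ`, by components: an element of `⊗ᵐ V*`. -/
abbrev Tens (n m : ℕ) : Type := (Fin m → Fin n) → ℝ

/-- The space `⊗⁴ V* ⊕ ⋯ ⊕ ⊗⁴⁺ᵖ V*` in which the curvature tensor and its first `p` covariant
derivatives take their values. -/
abbrev CurvSpace (n p : ℕ) : Type := (k : Fin (p + 1)) → Tens n (4 + (k : ℕ))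

/-- Action of an invertible linear map `X` of `V` on covariant tensors,
`(X · T)(v₁, …, vₘ) = T(X⁻¹ v₁, …, X⁻¹ vₘ)`. -/
def tensAct {n m : ℕ} (X : Matrix (Fin n) (Fin n) ℝ) (T : Tens n m) : Tens n m :=
  fun i => ∑ j : Fin m → Fin n, (∏ k, X⁻¹ (j k) (i k)) * T j

/-- The componentwise action on `⊗⁴ V* ⊕ ⋯ ⊕ ⊗⁴⁺ᵖ V*`. -/
def curvAct {n p : ℕ} (X : Matrix (Fin n) (Fin n) ℝ) (T : CurvSpace n p) : CurvSpace n p :=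
  fun k => tensAct X (T k)

/-- The group `O(η)` of automorphisms of `(V, η)`. -/
def orthGroup {n : ℕ} (η : Matrix (Fin n) (Fin n) ℝ) : Subgroup (GL (Fin n) ℝ) where
  carrier := {X | (X : Matrix (Fin n) (Fin n) ℝ)ᵀ * η * X = η}
  one_mem' := by simp
  mul_mem' := by
    intro X Y hX hY
    simp only [Set.mem_ofPred_eq, Units.val_mul, Matrix.transpose_mul] at *
    calc _ = (Y : Matrix (Fin n) (Fin n) ℝ)ᵀ *
          ((X : Matrix (Fin n) (Fin n) ℝ)ᵀ * η * X) * Y := by simp only [Matrix.mul_assoc]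
      _ = η := by rw [hX, hY]
  inv_mem' := by
    intro X hX
    simp only [Set.mem_ofPred_eq] at *
    have h1 : (X : Matrix (Fin n) (Fin n) ℝ) * ((X⁻¹ : GL (Fin n) ℝ) : Matrix _ _ ℝ) = 1 := by
      rw [← Units.val_mul, mul_inv_cancel, Units.val_one]
    have h2 : ((X⁻¹ : GL (Fin n) ℝ) : Matrix _ _ ℝ)ᵀ * (X : Matrix (Fin n) (Fin n) ℝ)ᵀ = 1 := by
      rw [← Matrix.transpose_mul, h1, Matrix.transpose_one]
    conv_lhs => rw [← hX]
    calc _ = (((X⁻¹ : GL (Fin n) ℝ) : Matrix _ _ ℝ)ᵀ * (X : Matrix (Fin n) (Fin n) ℝ)ᵀ) * η *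
          ((X : Matrix (Fin n) (Fin n) ℝ) * ((X⁻¹ : GL (Fin n) ℝ) : Matrix _ _ ℝ)) := by
            simp only [Matrix.mul_assoc]
      _ = η := by rw [h1, h2, Matrix.one_mul, Matrix.mul_one]

/-- The Lie algebra `𝔬(η)` of transformations of `V` that are anti self-dual for `η`. -/
def orthAlgebra {n : ℕ} (η : Matrix (Fin n) (Fin n) ℝ) : Set (Matrix (Fin n) (Fin n) ℝ) :=
  {A | Aᵀ * η + η * A = 0}

/-- The dimension of a (closed) matrix group: the dimension of its Lie algebra, which consists of
the generators of its one-parameter subgroups. -/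
def groupDim {n : ℕ} (G : Subgroup (GL (Fin n) ℝ)) : ℕ :=
  Module.finrank ℝ (Submodule.span ℝ
    {A : Matrix (Fin n) (Fin n) ℝ |
      ∀ t : ℝ, ∃ X ∈ G, (X : Matrix (Fin n) (Fin n) ℝ) = NormedSpace.exp (t • A)})

/-- `S` is a smooth submanifold of the finite-dimensional space `W`: the image of an injective
immersion of a (Hausdorff, second countable) manifold. This includes embedded submanifolds. -/
def IsSubmanifold {W : Type} [NormedAddCommGroup W] [NormedSpace ℝ W] (S : Set W) : Prop :=
  ∃ (d : ℕ) (N : Type) (_ : TopologicalSpace N) (_ : ChartedSpace (EuclideanSpace ℝ (Fin d)) N)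
    (f : N → W),
    T2Space N ∧ SecondCountableTopology N ∧ IsManifold (𝓡 d) ∞ N ∧
      Manifold.IsImmersion (𝓡 d) 𝓘(ℝ, W) ∞ f ∧ Function.Injective f ∧ Set.range f = S

/-! ### Metrics, moving frames, connection and curvature -/

section Geometry

variable {n : ℕ} {M : Type*} [TopologicalSpace M] [ChartedSpace (EuclideanSpace ℝ (Fin n)) M]

variable (M) in
/-- A smooth pseudo-Riemannian metric on the `n`-manifold `M` whose tangent spaces are isometric to
`(ℝⁿ, η)`, where `η` is a nondegenerate symmetric matrix. -/
structure Metric [IsManifold (𝓡 n) ∞ M] (η : Matrix (Fin n) (Fin n) ℝ) where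
  /-- the inner product of the tangent space at `x` -/
  val (x : M) : TangentSpace (𝓡 n) x →L[ℝ] TangentSpace (𝓡 n) x →L[ℝ] ℝ
  symm (x : M) (v w : TangentSpace (𝓡 n) x) : val x v w = val x w v
  exists_frame (x : M) :
    ∃ e : Fin n → TangentSpace (𝓡 n) x, ∀ a b, val x (e a) (e b) = η a b
  contMDiff : ContMDiff (𝓡 n)
    ((𝓡 n).prod 𝓘(ℝ, EuclideanSpace ℝ (Fin n) →L[ℝ] EuclideanSpace ℝ (Fin n) →L[ℝ] ℝ)) ∞
    (fun x => Bundle.TotalSpace.mk'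
      (EuclideanSpace ℝ (Fin n) →L[ℝ] EuclideanSpace ℝ (Fin n) →L[ℝ] ℝ) x (val x))

variable [IsManifold (𝓡 n) ∞ M] {η : Matrix (Fin n) (Fin n) ℝ}

/-- A moving `η`-orthogonal frame `(E₁, …, Eₙ)` of `(M, g)` on an open set `U`; giving it is the
same as giving the dual `η`-orthogonal moving coframe. The values outside `U` are irrelevant. -/
structure MovingFrame (g : Metric M η) where
  U : Set M
  isOpen : IsOpen U
  vec : Fin n → (x : M) → TangentSpace (𝓡 n) x
  smooth (a : Fin n) : ContMDiffOn (𝓡 n) (𝓡 n).tangent ∞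
    (fun x => (⟨x, vec a x⟩ : TangentBundle (𝓡 n) M)) U
  orth (a b : Fin n) : ∀ x ∈ U, g.val x (vec a x) (vec b x) = η a b

namespace MovingFrame

variable {g : Metric M η} (E : MovingFrame g)

/-- The derivative `E_a f` of a function along the frame field `E_a`. -/
def dir (a : Fin n) (f : M → ℝ) (x : M) : ℝ :=
  (mfderiv (𝓡 n) 𝓘(ℝ, ℝ) f x (E.vec a x) : ℝ)

/-- `g([E_a, E_b], E_c)`. -/
def bracketLow (a b c : Fin n) (x : M) : ℝ :=
  g.val x (VectorField.mlieBracket (𝓡 n) (E.vec a) (E.vec b) x) (E.vec c x)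

/-- The structure functions: `[E_a, E_b] = bracket a b c • E_c` (sum over `c`). -/
def bracket (a b c : Fin n) (x : M) : ℝ := ∑ d, η⁻¹ c d * E.bracketLow a b d x

/-- `g(∇_{E_a} E_b, E_c)` for the Levi-Civita connection `∇`. Since the inner products of
the frame fields are constant, this is the Koszul formula. -/
def connLow (a b c : Fin n) (x : M) : ℝ :=
  (E.bracketLow a b c x - E.bracketLow b c a x + E.bracketLow c a b x) / 2

/-- The connection components: `∇_{E_a} E_b = conn a b c • E_c` (sum over `c`). -/
def conn (a b c : Fin n) (x : M) : ℝ := ∑ d, η⁻¹ c d * E.connLow a b d x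

/-- The curvature components `Rᵃ_{bcd}`:
`∇_{E_c} ∇_{E_d} E_b - ∇_{E_d} ∇_{E_c} E_b - ∇_{[E_c, E_d]} E_b = Rᵃ_{bcd} E_a`. -/
def riemUp (a b c d : Fin n) (x : M) : ℝ :=
  E.dir c (E.conn d b a) x - E.dir d (E.conn c b a) x
    + ∑ f, (E.conn d b f x * E.conn c f a x - E.conn c b f x * E.conn d f a x)
    - ∑ f, E.bracket c d f x * E.conn f b a x

/-- The Riemann curvature components `R_{abcd}`. -/
def riem (x : M) : Tens n 4 :=
  fun i => ∑ e, η (i 0) e * E.riemUp e (i 1) (i 2) (i 3) x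

/-- The components `T_{a₁ … aₘ; e}` of the covariant derivative of the tensor field with
components `T_{a₁ … aₘ}` (the differentiation index comes last). -/
def covDeriv {m : ℕ} (T : M → Tens n m) (x : M) : Tens n (m + 1) :=
  fun i =>
    E.dir (i (Fin.last m)) (fun y => T y (Fin.init i)) x
      - ∑ j : Fin m, ∑ b, E.conn (i (Fin.last m)) (Fin.init i j) b x *
          T x (Function.update (Fin.init i) j b)

/-- The components `R_{abcd; e₁ … e_k}` of the `k`-th covariant derivative of the curvature. -/
def riemDeriv : (k : ℕ) → M → Tens n (4 + k)
  | 0 => E.riem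
  | k + 1 => E.covDeriv (riemDeriv k)

/-- `R^{(p)} = (R_{abcd}, R_{abcd; e}, …, R_{abcd; e₁ … e_p})` relative to the moving frame. -/
def curv (p : ℕ) (x : M) : CurvSpace n p := fun k => E.riemDeriv k x

/-- The rank at `x` of the map `R^{(p)} : U → ⊗⁴ V* ⊕ ⋯ ⊕ ⊗⁴⁺ᵖ V*`. -/
def rankAt (p : ℕ) (x : M) : ℕ :=
  Module.finrank ℝ (LinearMap.range
    (mfderiv (𝓡 n) 𝓘(ℝ, CurvSpace n p) (E.curv p) x).toLinearMap)

/-- The rank of the lifted map `R̂^{(p)} : O(η, M) → ⊗⁴ V* ⊕ ⋯ ⊕ ⊗⁴⁺ᵖ V*` on the bundle of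
`η`-orthogonal coframes, at the coframe `X · ω_x`, where `ω` is the coframe dual to `E`.
In the local trivialization `(y, X) ↦ X · ω_y` of the bundle, `R̂^{(p)}` is the map
`(y, X) ↦ X · R^{(p)}(y)` on `U × O(η)`; the image of its differential at `(x, X)` is spanned by
the derivatives along `U` and by those along the curves `t ↦ exp(t A) X` with `A ∈ 𝔬(η)`. -/
def liftRankAt (p : ℕ) (x : M) (X : Matrix (Fin n) (Fin n) ℝ) : ℕ :=
  Module.finrank ℝ (Submodule.span ℝ
    (Set.range (fun v : TangentSpace (𝓡 n) x =>
        (mfderiv (𝓡 n) 𝓘(ℝ, CurvSpace n p) (fun y => curvAct X (E.curv p y)) x v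
          : CurvSpace n p)) ∪
      {w : CurvSpace n p | ∃ A ∈ orthAlgebra η,
        w = deriv (fun t : ℝ => curvAct (NormedSpace.exp (t • A) * X) (E.curv p x)) 0}))

end MovingFrame

/-! ### Regularity, order, curvature homogeneity, pseudo-stabilization -/

variable (g : Metric M η)

/-- `R̂^{(p)} : O(η, M) → ⊗⁴ V* ⊕ ⋯ ⊕ ⊗⁴⁺ᵖ V*` has constant rank `r`; that is, `r_p = r`. -/
def HasRank (p r : ℕ) : Prop :=
  ∀ E : MovingFrame g, ∀ x ∈ E.U, ∀ X ∈ orthGroup η, E.liftRankAt p x X = r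

/-- `(M, g)` is fully regular: each `r_p` is constant. -/
def IsFullyRegular : Prop := ∀ p, ∃ r, HasRank g p r

/-- `r_{q-1} = r_q`, with the convention `r_{-1} = 0`. -/
def RankStable : ℕ → Prop
  | 0 => HasRank g 0 0
  | q + 1 => ∃ r, HasRank g q r ∧ HasRank g (q + 1) r

/-- `q` is the smallest integer such that `r_{q-1} = r_q`. -/
def IsStabIndex (q : ℕ) : Prop := IsLeast {q | RankStable g q} q

/-- `(M, g)` has order `m`, that is, `m = q - 1` with `q` the smallest integer such that
`r_{q-1} = r_q`. -/
def HasOrder (m : ℤ) : Prop := ∃ q : ℕ, IsStabIndex g q ∧ m = (q : ℤ) - 1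

/-- `S` is a `p`-th order normalizing cross-section for `(M, g)`, with group `G = G_p`. -/
structure IsNormalizing (p : ℕ) (S : Set (CurvSpace n p)) (G : Subgroup (GL (Fin n) ℝ)) :
    Prop where
  submanifold : IsSubmanifold S
  le : G ≤ orthGroup η
  /-- `G` fixes `S` pointwise. -/
  fixes : ∀ X ∈ G, ∀ s ∈ S, curvAct (X : Matrix (Fin n) (Fin n) ℝ) s = s
  /-- the normalization is maximal. -/
  maximal : ∀ X ∈ orthGroup η,
    (curvAct (X : Matrix (Fin n) (Fin n) ℝ) '' S ∩ S).Nonempty → X ∈ G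
  /-- `M` is covered by moving frames relative to which `R^{(p)}` takes values in `S`. -/
  cover : ∀ x : M, ∃ E : MovingFrame g, x ∈ E.U ∧ ∀ y ∈ E.U, E.curv p y ∈ S

/-- `(M, g)` is curvature regular. -/
def IsCurvatureRegular : Prop := ∀ p, ∃ S G, IsNormalizing g p S G

/-- The `p`-th order degree of frame freedom is `s`; that is, `s_p = dim G_p = s`. -/
def HasFrameFreedom (p s : ℕ) : Prop := ∃ S G, IsNormalizing g p S G ∧ groupDim G = s

/-- The `p`-th order horizontal rank is `t`; that is, `t_p = rank R^{(p)} = t` relative to the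
moving frames normalized by some cross-section. -/
def HasHorizontalRank (p t : ℕ) : Prop :=
  ∃ S G, IsNormalizing g p S G ∧
    ∀ E : MovingFrame g, (∀ y ∈ E.U, E.curv p y ∈ S) → ∀ x ∈ E.U, E.rankAt p x = t

/-- `(M, g)` is curvature homogeneous of order `k`, or `CH_k`: it is curvature regular and
`t_k = 0`. -/
def IsCurvatureHomogeneous (k : ℕ) : Prop := IsCurvatureRegular g ∧ HasHorizontalRank g k 0

/-- `(M, g)` has `k`-th order pseudo-stabilization (`k ≥ 1`): it is curvature regular and
`s_k = s_{k-1} > s_q`, where `q` is the smallest integer such that `r_{q-1} = r_q`. -/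
def HasPseudoStabilization (k : ℕ) : Prop :=
  1 ≤ k ∧ IsCurvatureRegular g ∧ ∃ q s s' : ℕ, IsStabIndex g q ∧
    HasFrameFreedom g k s ∧ HasFrameFreedom g (k - 1) s ∧ HasFrameFreedom g q s' ∧ s' < s

namespace MovingFrame

variable {g} (E : MovingFrame g)

/-- The Ricci components `R_{ab} = Rᶜ_{acb}`. -/
def ricci (a b : Fin n) (x : M) : ℝ := ∑ c, E.riemUp c a c b x

/-- The curvature scalar `R = Rᵃ_a`. -/
def scalar (x : M) : ℝ := ∑ a, ∑ b, η⁻¹ a b * E.ricci a b x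

/-- The trace-free part `S_{ab} = R_{ab} - (R / n) η_{ab}` of the Ricci tensor. -/
def traceFreeRicci (a b : Fin n) (x : M) : ℝ := E.ricci a b x - E.scalar x / n * η a b

end MovingFrame

end Geometry

/-! ### Three-dimensional Lorentzian geometry -/

/-- The Lorentzian inner product relative to a null triad `(ℓ, m, n)`: `η(ℓ, n) = -1`,
`η(m, m) = 1/2`, all other products being zero. -/
def etaNull : Matrix (Fin 3) (Fin 3) ℝ := !![0, 0, -1; 0, 1 / 2, 0; -1, 0, 0]

/-- The curvature is of Petrov type N at `x`: relative to a suitable null triad,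
`(S_{ab}) = (Ψ₀ Ψ₁ Ψ₂; Ψ₁ Ψ₂ Ψ₃; Ψ₂ Ψ₃ Ψ₄)` with `Ψ₀ = Ψ₁ = Ψ₂ = Ψ₃ = 0` and `Ψ₄ = ±1`. -/
def IsTypeNAt {M : Type*} [TopologicalSpace M] [ChartedSpace (EuclideanSpace ℝ (Fin 3)) M]
    [IsManifold (𝓡 3) ∞ M] (g : Metric M etaNull) (x : M) : Prop :=
  ∃ E : MovingFrame g, x ∈ E.U ∧ ∃ Ψ₄ : ℝ, (Ψ₄ = 1 ∨ Ψ₄ = -1) ∧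
    ∀ a b, E.traceFreeRicci a b x = (!![0, 0, 0; 0, 0, 0; 0, 0, Ψ₄] : Matrix _ _ ℝ) a b

end CurvHom

end

/-! The order is bounded by counting ranks. The bundle of null triads has dimension 3 + 3 = 6, so
r_p ≤ 6. If q were at least 5, the ranks would satisfy r_0 < r_1 < r_2 < r_3 < r_4, leaving very
little room.

CH_0 and type N give local frames (ℓ, m, n), indexed 0, 1, 2, in which the curvature is a constant
tensor `modelRiem K P` with P ≠ 0. Its infinitesimal isotropy is exactly the line of null rotations
about ℓ, so two of the three vertical directions move it and r_0 ≥ 2 (`two_le_liftRankAt_one`).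
Pseudo-stabilization makes G_k positive-dimensional for some k ≥ 1, so R and ∇R share an
infinitesimal symmetry, which must be that null rotation (`exists_isAdapted`). Invariance of ∇R
constrains the connection (`IsAdapted.conn`): ∇_ℓ ℓ = 0, ℓ has no expansion along m, and g(∇_n ℓ, m)
= -B, where B = g(∇_m ℓ, n) is `connLow 1 0 2`. The structure equations then read ℓ(B) = 0, m(B) =
B² + K/2 and ℓ(g(∇_n ℓ, n)) = 2(B² + K/2).

There are two cases. If B² + K/2 vanishes on the domain of the frame, ℓ behaves like a multiple of a
Killing field: it acts on every covariant derivative of R as an infinitesimal null rotation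
(`dirTens_zero`, by way of `dirTens_covDeriv`). One horizontal direction is then redundant, so r_4 ≤
5, whereas r_0 ≥ 2 forces r_4 ≥ 6. If B² + K/2 ≠ 0 at some point, the derivatives of ∇R along ℓ and
m are independent of each other and of the two vertical directions already counted, so r_1 ≥ 4 and
r_4 ≥ 7 > 6.

Much of the file is groundwork: commutators of frame derivatives, the tensor character of R and its
covariant derivatives, and the description of the lifted rank by frame derivatives and derivations
of the tensor algebra. -/

/-! ### Smooth functions on a frame domain and their frame derivatives. -/

noncomputable section
namespace CurvHom
namespace MovingFrame

variable {n : ℕ} {M : Type*} [TopologicalSpace M] [ChartedSpace (EuclideanSpace ℝ (Fin n)) M]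
  [IsManifold (𝓡 n) ∞ M] {η : Matrix (Fin n) (Fin n) ℝ} {g : Metric M η} (E : MovingFrame g)

/-- Smoothness of a function on the domain of a moving frame. -/
def Smooth (f : M → ℝ) : Prop := ContMDiffOn (𝓡 n) 𝓘(ℝ, ℝ) ∞ f E.U

variable {E} {f h : M → ℝ} {x : M}

theorem Smooth.mdifferentiableAt (hf : E.Smooth f) (hx : x ∈ E.U) :
    MDifferentiableAt (𝓡 n) 𝓘(ℝ, ℝ) f x :=
  ((hf x hx).contMDiffAt (E.isOpen.mem_nhds hx)).mdifferentiableAt (by simp)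

theorem Smooth.contMDiffAt (hf : E.Smooth f) (hx : x ∈ E.U) :
    ContMDiffAt (𝓡 n) 𝓘(ℝ, ℝ) ∞ f x :=
  (hf x hx).contMDiffAt (E.isOpen.mem_nhds hx)

theorem smooth_const (c : ℝ) : E.Smooth (fun _ => c) := contMDiffOn_const

theorem Smooth.add (hf : E.Smooth f) (hh : E.Smooth h) : E.Smooth (fun x => f x + h x) :=
  ContMDiffOn.add hf hh

theorem Smooth.sub (hf : E.Smooth f) (hh : E.Smooth h) : E.Smooth (fun x => f x - h x) :=
  ContMDiffOn.sub hf hh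

theorem Smooth.neg (hf : E.Smooth f) : E.Smooth (fun x => - f x) :=
  ContMDiffOn.neg hf

theorem Smooth.mul (hf : E.Smooth f) (hh : E.Smooth h) : E.Smooth (fun x => f x * h x) :=
  ContMDiffOn.mul hf hh

theorem Smooth.div_const (hf : E.Smooth f) (c : ℝ) : E.Smooth (fun x => f x / c) := by
  simpa only [div_eq_mul_inv] using hf.mul (smooth_const c⁻¹)

theorem smooth_sum {ι : Type*} {s : Finset ι} {f : ι → M → ℝ} (hf : ∀ i ∈ s, E.Smooth (f i)) :
    E.Smooth (fun x => ∑ i ∈ s, f i x) :=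
  contMDiffOn_finsetSum hf

theorem smooth_prod {ι : Type*} {s : Finset ι} {f : ι → M → ℝ} (hf : ∀ i ∈ s, E.Smooth (f i)) :
    E.Smooth (fun x => ∏ i ∈ s, f i x) :=
  contMDiffOn_finsetProd hf

theorem Smooth.congr (hf : E.Smooth f) (hfh : ∀ y ∈ E.U, h y = f y) : E.Smooth h :=
  ContMDiffOn.congr hf hfh

theorem mdifferentiableAt_vec (E : MovingFrame g) (a : Fin n) (hx : x ∈ E.U) :
    MDifferentiableAt (𝓡 n) (𝓡 n).tangent
      (fun x => (⟨x, E.vec a x⟩ : TangentBundle (𝓡 n) M)) x :=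
  ((E.smooth a x hx).contMDiffAt (E.isOpen.mem_nhds hx)).mdifferentiableAt (by simp)

theorem contMDiffAt_vec (E : MovingFrame g) (a : Fin n) (hx : x ∈ E.U) :
    ContMDiffAt (𝓡 n) (𝓡 n).tangent ∞
      (fun x => (⟨x, E.vec a x⟩ : TangentBundle (𝓡 n) M)) x :=
  (E.smooth a x hx).contMDiffAt (E.isOpen.mem_nhds hx)

/-! ### The frame derivatives -/

theorem dir_eq (a : Fin n) : E.dir a f x = mvfderiv (𝓡 n) f x (E.vec a x) := rfl

theorem dir_congr (a : Fin n) (hx : x ∈ E.U) (hfh : ∀ y ∈ E.U, f y = h y) :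
    E.dir a f x = E.dir a h x := by
  have : f =ᶠ[nhds x] h := Filter.eventuallyEq_of_mem (E.isOpen.mem_nhds hx) hfh
  simp only [dir, this.mfderiv_eq]
  rfl

theorem dir_const (a : Fin n) (c : ℝ) : E.dir a (fun _ => c) x = 0 := by
  rw [dir_eq, mvfderiv_const]; rfl

theorem dir_add (a : Fin n) (hx : x ∈ E.U) (hf : E.Smooth f) (hh : E.Smooth h) :
    E.dir a (fun y => f y + h y) x = E.dir a f x + E.dir a h x := by
  simp [dir_eq, mvfderiv_fun_add (hf.mdifferentiableAt hx) (hh.mdifferentiableAt hx)]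

theorem dir_sub (a : Fin n) (hx : x ∈ E.U) (hf : E.Smooth f) (hh : E.Smooth h) :
    E.dir a (fun y => f y - h y) x = E.dir a f x - E.dir a h x := by
  simp [dir_eq, mvfderiv_fun_sub (hf.mdifferentiableAt hx) (hh.mdifferentiableAt hx)]

theorem dir_neg (a : Fin n) :
    E.dir a (fun y => - f y) x = - E.dir a f x := by
  simp [dir_eq, mvfderiv_fun_neg]

theorem dir_mul (a : Fin n) (hx : x ∈ E.U) (hf : E.Smooth f) (hh : E.Smooth h) :
    E.dir a (fun y => f y * h y) x = f x * E.dir a h x + h x * E.dir a f x := by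
  simp [dir_eq, mvfderiv_fun_mul (hf.mdifferentiableAt hx) (hh.mdifferentiableAt hx)]

theorem dir_const_mul (a : Fin n) (c : ℝ) (hx : x ∈ E.U) (hh : E.Smooth h) :
    E.dir a (fun y => c * h y) x = c * E.dir a h x := by
  simp [dir_mul a hx (smooth_const c) hh, dir_const]

theorem dir_sum {ι : Type*} (a : Fin n) (s : Finset ι) {f : ι → M → ℝ} (hx : x ∈ E.U)
    (hf : ∀ i ∈ s, E.Smooth (f i)) :
    E.dir a (fun y => ∑ i ∈ s, f i y) x = ∑ i ∈ s, E.dir a (f i) x := by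
  classical
  induction s using Finset.induction_on with
  | empty => simp [dir_const]
  | insert i s hi ih =>
    simp only [Finset.sum_insert hi]
    rw [dir_add a hx (hf i (by simp)) (smooth_sum fun j hj => hf j (by simp [hj])),
      ih fun j hj => hf j (by simp [hj])]

theorem Smooth.dir (hf : E.Smooth f) (a : Fin n) : E.Smooth (E.dir a f) := by
  have h1 := (ContMDiffOn.contMDiffOn_tangentMapWithin (m := ∞) hf (by simp)
    E.isOpen.uniqueMDiffOn).comp (E.smooth a) (fun y hy => hy)
  have h2 := (contMDiff_snd_tangentBundle_modelSpace (n := ∞) ℝ 𝓘(ℝ, ℝ)).comp_contMDiffOn h1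
  refine Smooth.congr (E := E) h2 fun y hy => ?_
  simp only [MovingFrame.dir, Function.comp, tangentMapWithin]
  rw [mfderivWithin_of_isOpen E.isOpen hy]

theorem smooth_inner {V W : (x : M) → TangentSpace (𝓡 n) x}
    (hV : ContMDiffOn (𝓡 n) (𝓡 n).tangent ∞ (fun x => (⟨x, V x⟩ : TangentBundle (𝓡 n) M)) E.U)
    (hW : ContMDiffOn (𝓡 n) (𝓡 n).tangent ∞ (fun x => (⟨x, W x⟩ : TangentBundle (𝓡 n) M)) E.U) :
    E.Smooth (fun x => g.val x (V x) (W x)) := by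
  have : ContMDiffOn (𝓡 n) ((𝓡 n).prod 𝓘(ℝ, ℝ)) ∞
      (fun m ↦ Bundle.TotalSpace.mk' ℝ (E := Bundle.Trivial M ℝ) m (g.val m (V m) (W m))) E.U :=
    ContMDiffOn.clm_bundle_apply₂ (F₁ := EuclideanSpace ℝ (Fin n))
      (F₂ := EuclideanSpace ℝ (Fin n)) g.contMDiff.contMDiffOn hV hW
  intro x hx
  have h2 := this x hx
  simp only [Bundle.contMDiffWithinAt_section] at h2
  exact h2

theorem smooth_mlieBracket (E : MovingFrame g) (a b : Fin n) :
    ContMDiffOn (𝓡 n) (𝓡 n).tangent ∞ (fun x => (⟨x,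
      VectorField.mlieBracket (𝓡 n) (E.vec a) (E.vec b) x⟩ : TangentBundle (𝓡 n) M)) E.U := by
  intro x hx
  have : IsManifold (𝓡 n) ((⊤ : ℕ∞) + 1 : WithTop ℕ∞) M := by simpa
  have : IsManifold (𝓡 n) (minSmoothness ℝ 2) M :=
    IsManifold.of_le (n := ∞) (by simp; exact WithTop.coe_le_coe.2 (le_top (a := (2 : ℕ∞))))
  exact (ContMDiffAt.mlieBracket_vectorField (m := ⊤) (n := ⊤) (E.contMDiffAt_vec a hx)
    (E.contMDiffAt_vec b hx) (by simp)).contMDiffWithinAt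

theorem smooth_bracketLow (a b c : Fin n) : E.Smooth (E.bracketLow a b c) :=
  smooth_inner (E.smooth_mlieBracket a b) (E.smooth c)

theorem smooth_bracket (a b c : Fin n) : E.Smooth (E.bracket a b c) :=
  smooth_sum fun _ _ => (smooth_const _).mul (smooth_bracketLow _ _ _)

theorem smooth_connLow (a b c : Fin n) : E.Smooth (E.connLow a b c) :=
  (((smooth_bracketLow _ _ _).sub (smooth_bracketLow _ _ _)).add
    (smooth_bracketLow _ _ _)).div_const 2

theorem smooth_conn (a b c : Fin n) : E.Smooth (E.conn a b c) :=
  smooth_sum fun _ _ => (smooth_const _).mul (smooth_connLow _ _ _)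

theorem smooth_riemUp (a b c d : Fin n) : E.Smooth (E.riemUp a b c d) :=
  ((((smooth_conn _ _ _).dir _).sub ((smooth_conn _ _ _).dir _)).add
    (smooth_sum fun _ _ => ((smooth_conn _ _ _).mul (smooth_conn _ _ _)).sub
      ((smooth_conn _ _ _).mul (smooth_conn _ _ _)))).sub
    (smooth_sum fun _ _ => (smooth_bracket _ _ _).mul (smooth_conn _ _ _))

theorem smooth_riem (i : Fin 4 → Fin n) : E.Smooth (fun x => E.riem x i) :=
  smooth_sum fun _ _ => (smooth_const _).mul (smooth_riemUp _ _ _ _)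

theorem smooth_covDeriv {m : ℕ} {T : M → Tens n m} (hT : ∀ i, E.Smooth (fun x => T x i))
    (i : Fin (m + 1) → Fin n) : E.Smooth (fun x => E.covDeriv T x i) :=
  ((hT _).dir _).sub (smooth_sum fun _ _ => smooth_sum fun _ _ => (smooth_conn _ _ _).mul (hT _))

theorem smooth_riemDeriv (k : ℕ) (i : Fin (4 + k) → Fin n) :
    E.Smooth (fun x => E.riemDeriv k x i) := by
  induction k with
  | zero => exact smooth_riem i
  | succ k ih => exact smooth_covDeriv ih i

end MovingFrame
end CurvHom
end

/-! ### Frame expansions and the commutator of frame derivatives. -/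

noncomputable section
namespace CurvHom
namespace MovingFrame

variable {n : ℕ} {M : Type*} [TopologicalSpace M] [ChartedSpace (EuclideanSpace ℝ (Fin n)) M]
  [IsManifold (𝓡 n) ∞ M] {η : Matrix (Fin n) (Fin n) ℝ} {g : Metric M η} {E : MovingFrame g}
  {f h : M → ℝ} {x : M}

theorem symm_of_mem (E : MovingFrame g) (hx : x ∈ E.U) (a b : Fin n) : η a b = η b a := by
  rw [← E.orth a b x hx, ← E.orth b a x hx, g.symm]

theorem linearIndependent_vec (E : MovingFrame g) (hη : IsUnit η.det) (hx : x ∈ E.U) :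
    LinearIndependent ℝ (fun a => E.vec a x) := by
  rw [Fintype.linearIndependent_iff]
  intro c hc
  have h1 : c ᵥ* η = 0 := by
    ext d
    have := congrArg (fun v => g.val x v (E.vec d x)) hc
    simpa [Matrix.vecMul, dotProduct, E.orth _ _ x hx] using this
  have h2 : c = 0 := by
    have := congrArg (· ᵥ* η⁻¹) h1
    simpa [Matrix.vecMul_vecMul, Matrix.mul_nonsing_inv _ hη] using this
  exact fun i => congrFun h2 i

theorem expansion (E : MovingFrame g) (hη : IsUnit η.det) (hx : x ∈ E.U)
    (v : TangentSpace (𝓡 n) x) :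
    v = ∑ c, (∑ d, η⁻¹ c d * g.val x v (E.vec d x)) • E.vec c x := by
  have hli := E.linearIndependent_vec hη hx
  have hcard : Fintype.card (Fin n) = Module.finrank ℝ (TangentSpace (𝓡 n) x) := by
    change _ = Module.finrank ℝ (EuclideanSpace ℝ (Fin n))
    simp
  have : FiniteDimensional ℝ (TangentSpace (𝓡 n) x) :=
    inferInstanceAs (FiniteDimensional ℝ (EuclideanSpace ℝ (Fin n)))
  have hv : v ∈ Submodule.span ℝ (Set.range fun a => E.vec a x) := by
    rw [hli.span_eq_top_of_card_eq_finrank' hcard]; trivial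
  obtain ⟨w, hw⟩ := (Submodule.mem_span_range_iff_exists_fun ℝ).1 hv
  conv_lhs => rw [← hw]
  refine Finset.sum_congr rfl fun c _ => ?_
  congr 1
  have h1 : ∀ d, g.val x v (E.vec d x) = (η *ᵥ w) d := by
    intro d
    rw [← hw]
    simp only [map_sum, map_smul, sum_apply, smul_apply,
      E.orth _ _ x hx, smul_eq_mul, Matrix.mulVec, dotProduct]
    exact Finset.sum_congr rfl fun b _ => by rw [E.symm_of_mem hx b d, mul_comm]
  simp only [h1]
  have h2 : η⁻¹ *ᵥ (η *ᵥ w) = w := by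
    rw [Matrix.mulVec_mulVec, Matrix.nonsing_inv_mul _ hη, Matrix.one_mulVec]
  conv_lhs => rw [← h2]
  rfl

theorem mlieBracket_vec (E : MovingFrame g) (hη : IsUnit η.det) (hx : x ∈ E.U) (a b : Fin n) :
    VectorField.mlieBracket (𝓡 n) (E.vec a) (E.vec b) x = ∑ c, E.bracket a b c x • E.vec c x :=
  E.expansion hη hx _

theorem mlieBracket_vec_smul (a b : Fin n) (hx : x ∈ E.U) (hf : E.Smooth f) :
    VectorField.mlieBracket (𝓡 n) (E.vec a) (f • E.vec b) x =
      E.dir a f x • E.vec b x + f x • VectorField.mlieBracket (𝓡 n) (E.vec a) (E.vec b) x :=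
  VectorField.mlieBracket_smul_right (hf.mdifferentiableAt hx) (E.mdifferentiableAt_vec b hx)

/-- The bracket of two frame fields is the commutator of the frame derivatives. -/
theorem mvfderiv_mlieBracket_vec (hη : IsUnit η.det) (a b : Fin n) (hx : x ∈ E.U)
    (hf : E.Smooth f) :
    mvfderiv (𝓡 n) f x (VectorField.mlieBracket (𝓡 n) (E.vec a) (E.vec b) x) =
      E.dir a (E.dir b f) x - E.dir b (E.dir a f) x := by
  have hM1 : IsManifold (𝓡 n) ((⊤ : ℕ∞) + 1 : WithTop ℕ∞) M := by simpa
  have hM : IsManifold (𝓡 n) (minSmoothness ℝ 3) M :=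
    IsManifold.of_le (n := ∞) (by simp; exact WithTop.coe_le_coe.2 (le_top (a := (3 : ℕ∞))))
  have hsm : ∀ {V : (x : M) → TangentSpace (𝓡 n) x},
      ContMDiffOn (𝓡 n) (𝓡 n).tangent ∞ (fun x => (⟨x, V x⟩ : TangentBundle (𝓡 n) M)) E.U →
      ContMDiffAt (𝓡 n) (𝓡 n).tangent (minSmoothness ℝ 2)
        (fun x => (⟨x, V x⟩ : TangentBundle (𝓡 n) M)) x := fun hV =>
    ((hV x hx).contMDiffAt (E.isOpen.mem_nhds hx)).of_le (by
      simp; exact WithTop.coe_le_coe.2 (le_top (a := (2 : ℕ∞))))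
  have hfs : ∀ {φ : M → ℝ} {V : (x : M) → TangentSpace (𝓡 n) x}, E.Smooth φ →
      ContMDiffOn (𝓡 n) (𝓡 n).tangent ∞ (fun x => (⟨x, V x⟩ : TangentBundle (𝓡 n) M)) E.U →
      ContMDiffOn (𝓡 n) (𝓡 n).tangent ∞
        (fun x => (⟨x, (φ • V) x⟩ : TangentBundle (𝓡 n) M)) E.U := fun hφ hV => by
    exact ContMDiffOn.smul_section hφ hV
  have hmd : ∀ {V : (x : M) → TangentSpace (𝓡 n) x},
      ContMDiffOn (𝓡 n) (𝓡 n).tangent ∞ (fun x => (⟨x, V x⟩ : TangentBundle (𝓡 n) M)) E.U →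
      MDifferentiableAt (𝓡 n) (𝓡 n).tangent
        (fun x => (⟨x, V x⟩ : TangentBundle (𝓡 n) M)) x := fun hV =>
    ((hV x hx).contMDiffAt (E.isOpen.mem_nhds hx)).mdifferentiableAt (by simp)
  have hU := E.smooth a
  -- The commutator formula is extracted from the Jacobi identity. Written for (E_a, E_b, f E_a),
  -- with f times its instance for (E_a, E_b, E_a) removed, the identity leaves a scalar multiple of
  -- E_a(x), and that vector is nonzero.
  have hJ := VectorField.leibniz_identity_mlieBracket_apply (hsm (E.smooth a)) (hsm (E.smooth b))
    (hsm (E.smooth a))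
  have hJf := VectorField.leibniz_identity_mlieBracket_apply (hsm (E.smooth a)) (hsm (E.smooth b))
    (hsm (hfs hf (E.smooth a)))
  have key : ∀ c, VectorField.mlieBracket (𝓡 n) (E.vec c) (f • E.vec a) =ᶠ[nhds x]
      E.dir c f • E.vec a + f • VectorField.mlieBracket (𝓡 n) (E.vec c) (E.vec a) := fun c =>
    Filter.eventuallyEq_of_mem (E.isOpen.mem_nhds hx) fun y hy => mlieBracket_vec_smul c a hy hf
  have key2 : ∀ c d, VectorField.mlieBracket (𝓡 n) (E.vec d)
      (VectorField.mlieBracket (𝓡 n) (E.vec c) (f • E.vec a)) x =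
      E.dir d (E.dir c f) x • E.vec a x +
      E.dir c f x • VectorField.mlieBracket (𝓡 n) (E.vec d) (E.vec a) x +
      (E.dir d f x • VectorField.mlieBracket (𝓡 n) (E.vec c) (E.vec a) x +
      f x • VectorField.mlieBracket (𝓡 n) (E.vec d)
        (VectorField.mlieBracket (𝓡 n) (E.vec c) (E.vec a)) x) := by
    intro c d
    rw [Filter.EventuallyEq.rfl.mlieBracket_vectorField_eq (key c),
      VectorField.mlieBracket_add_right (hmd (hfs (hf.dir c) (E.smooth a)))
        (hmd (hfs hf (E.smooth_mlieBracket c a))), mlieBracket_vec_smul d a hx (hf.dir c),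
      VectorField.mlieBracket_smul_right (hf.mdifferentiableAt hx) (hmd (E.smooth_mlieBracket c a))]
    rfl
  rw [key2, key2, VectorField.mlieBracket_smul_right (hf.mdifferentiableAt hx) (hmd (E.smooth a)),
    hJ] at hJf
  have hne : E.vec a x ≠ 0 := (E.linearIndependent_vec hη hx).ne_zero a
  have h3 : (mvfderiv (𝓡 n) f x (VectorField.mlieBracket (𝓡 n) (E.vec a) (E.vec b) x) -
      (E.dir a (E.dir b f) x - E.dir b (E.dir a f) x)) • E.vec a x = 0 := by
    rw [sub_smul, sub_smul, sub_eq_zero]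
    rw [smul_add] at hJf
    generalize E.dir a (E.dir b f) x • E.vec a x = t1 at *
    generalize E.dir b (E.dir a f) x • E.vec a x = t2 at *
    have := sub_eq_zero.2 hJf
    rw [← sub_eq_zero, ← neg_eq_zero, ← this]
    abel
  exact sub_eq_zero.1 ((smul_eq_zero.1 h3).resolve_right hne)

theorem dir_comm (hη : IsUnit η.det) (a b : Fin n) (hx : x ∈ E.U) (hf : E.Smooth f) :
    E.dir a (E.dir b f) x - E.dir b (E.dir a f) x = ∑ c, E.bracket a b c x * E.dir c f x := by
  rw [← mvfderiv_mlieBracket_vec hη a b hx hf, E.mlieBracket_vec hη hx]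
  simp [dir_eq]

end MovingFrame
end CurvHom
end

noncomputable section
namespace CurvHom

/-! ### Tensor algebra -/

namespace Tens

variable {n m : ℕ}

/-- The derivation of the tensor algebra defined by a matrix. -/
def der (A : Matrix (Fin n) (Fin n) ℝ) (T : Tens n m) : Tens n m :=
  fun i => ∑ k, ∑ b, A (i k) b * T (Function.update i k b)

/-- The components of a tensor relative to the frame `∑ b, Z a b • e b`. -/
def act (Z : Matrix (Fin n) (Fin n) ℝ) (T : Tens n m) : Tens n m :=
  fun i => ∑ j : Fin m → Fin n, (∏ k, Z (i k) (j k)) * T j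

/-- The derivative of `act Z T` with respect to `Z` in the direction `W`. -/
def dact (Z W : Matrix (Fin n) (Fin n) ℝ) (T : Tens n m) : Tens n m :=
  fun i => ∑ j : Fin m → Fin n,
    (∑ k, W (i k) (j k) * ∏ k' ∈ Finset.univ.erase k, Z (i k') (j k')) * T j

theorem tensAct_eq_act (X : Matrix (Fin n) (Fin n) ℝ) (T : Tens n m) :
    tensAct X T = act (X⁻¹)ᵀ T := rfl

theorem der_sub (A : Matrix (Fin n) (Fin n) ℝ) (T S : Tens n m) :
    der A (T - S) = der A T - der A S := by
  ext i; simp [der, mul_sub, Finset.sum_sub_distrib]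

theorem der_smul (A : Matrix (Fin n) (Fin n) ℝ) (c : ℝ) (T : Tens n m) :
    der A (c • T) = c • der A T := by
  ext i; simp [der, Finset.mul_sum, mul_left_comm]

theorem add_der (A B : Matrix (Fin n) (Fin n) ℝ) (T : Tens n m) :
    der (A + B) T = der A T + der B T := by
  ext i; simp [der, add_mul, Finset.sum_add_distrib]

theorem sub_der (A B : Matrix (Fin n) (Fin n) ℝ) (T : Tens n m) :
    der (A - B) T = der A T - der B T := by
  ext i; simp [der, sub_mul, Finset.sum_sub_distrib]

theorem smul_der (c : ℝ) (A : Matrix (Fin n) (Fin n) ℝ) (T : Tens n m) :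
    der (c • A) T = c • der A T := by
  ext i; simp [der, Finset.mul_sum, mul_assoc]

theorem sum_der {ι : Type*} (s : Finset ι) (A : ι → Matrix (Fin n) (Fin n) ℝ) (T : Tens n m) :
    der (∑ k ∈ s, A k) T = ∑ k ∈ s, der (A k) T := by
  classical
  induction s using Finset.induction_on with
  | empty => ext i; simp [der]
  | insert k s hk ih => rw [Finset.sum_insert hk, Finset.sum_insert hk, add_der, ih]

theorem dact_add (Z W W' : Matrix (Fin n) (Fin n) ℝ) (T : Tens n m) :
    dact Z (W + W') T = dact Z W T + dact Z W' T := by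
  ext i; simp [dact, add_mul, Finset.sum_add_distrib]

theorem act_sub (Z : Matrix (Fin n) (Fin n) ℝ) (T S : Tens n m) :
    act Z (T - S) = act Z T - act Z S := by
  ext i; simp [act, mul_sub, Finset.sum_sub_distrib]

theorem act_smul (Z : Matrix (Fin n) (Fin n) ℝ) (c : ℝ) (T : Tens n m) :
    act Z (c • T) = c • act Z T := by
  ext i; simp [act, Finset.mul_sum, mul_left_comm]

theorem act_sum {ι : Type*} (s : Finset ι) (Z : Matrix (Fin n) (Fin n) ℝ) (T : ι → Tens n m) :
    act Z (∑ k ∈ s, T k) = ∑ k ∈ s, act Z (T k) := by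
  ext i
  simp only [act, Finset.sum_apply, Finset.mul_sum]
  exact Finset.sum_comm

theorem act_one (T : Tens n m) : act 1 T = T := by
  ext i
  rw [act, Finset.sum_eq_single i]
  · simp
  · intro j _ hj
    obtain ⟨k, hk⟩ := Function.ne_iff.1 hj
    rw [Finset.prod_eq_zero (Finset.mem_univ k), zero_mul]
    simp [Ne.symm hk]
  · simp

theorem der_act (A Z : Matrix (Fin n) (Fin n) ℝ) (T : Tens n m) :
    der A (act Z T) = dact Z (A * Z) T := by
  ext i
  simp only [der, act, dact, Finset.mul_sum, Finset.sum_mul]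
  rw [Finset.sum_comm' (t' := Finset.univ) (s' := fun _ => Finset.univ) (by simp)]
  conv_rhs => rw [Finset.sum_comm]
  rw [Finset.sum_comm]
  refine Finset.sum_congr rfl fun k _ => ?_
  rw [Finset.sum_comm]
  refine Finset.sum_congr rfl fun j _ => ?_
  simp only [Matrix.mul_apply, Finset.sum_mul]
  refine Finset.sum_congr rfl fun b _ => ?_
  rw [← Finset.mul_prod_erase Finset.univ _ (Finset.mem_univ k), Function.update_self]
  rw [Finset.prod_congr (s₂ := Finset.univ.erase k) (g := fun k' => Z (i k') (j k')) rfl]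
  · ring
  · intro k' hk'
    rw [Function.update_of_ne (Finset.ne_of_mem_erase hk')]

theorem act_der (A Z : Matrix (Fin n) (Fin n) ℝ) (T : Tens n m) :
    act Z (der A T) = dact Z (Z * A) T := by
  ext i
  simp only [der, act, dact, Finset.mul_sum, Finset.sum_mul, Matrix.mul_apply]
  rw [Finset.sum_comm]
  conv_rhs => rw [Finset.sum_comm]
  refine Finset.sum_congr rfl fun k _ => ?_
  rw [← Fintype.sum_prod_type', ← Fintype.sum_prod_type']
  -- The reindexing exchanges the value of `j` at slot `k` with the summed index; it is an
  -- involution.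
  refine Finset.sum_nbij' (fun p => (Function.update p.1 k p.2, p.1 k))
    (fun p => (Function.update p.1 k p.2, p.1 k)) (by simp) (by simp) (by simp) (by simp) ?_
  rintro ⟨j, b⟩ -
  simp only [Function.update_self]
  rw [← Finset.mul_prod_erase Finset.univ _ (Finset.mem_univ k)]
  rw [Finset.prod_congr (s₂ := Finset.univ.erase k)
    (g := fun k' => Z (i k') (Function.update j k b k')) rfl]
  · ring
  · intro k' hk'
    rw [Function.update_of_ne (Finset.ne_of_mem_erase hk')]

theorem dact_one (W : Matrix (Fin n) (Fin n) ℝ) (T : Tens n m) : dact 1 W T = der W T := by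
  rw [← act_one (der W T), act_der, one_mul]

/-- When both derivations act on the same slot they compose to the product matrix. When they act on
distinct slots they commute, so these terms cancel in the difference. -/
theorem der_der_sub (A B : Matrix (Fin n) (Fin n) ℝ) (T : Tens n m) :
    der A (der B T) - der B (der A T) = der (A * B - B * A) T := by
  have key : ∀ A B : Matrix (Fin n) (Fin n) ℝ, ∀ i, der A (der B T) i = der (A * B) T i +
      ∑ k, ∑ l ∈ Finset.univ.erase k, ∑ b, ∑ c, A (i k) b * B (i l) c *
        T (Function.update (Function.update i k b) l c) := by
    intro A B i
    simp only [der]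
    rw [← Finset.sum_add_distrib]
    refine Finset.sum_congr rfl fun k _ => ?_
    simp only [Finset.mul_sum]
    have h : ∀ b, (∑ l, ∑ c, A (i k) b * (B (Function.update i k b l) c *
        T (Function.update (Function.update i k b) l c))) =
        (∑ c, A (i k) b * B b c * T (Function.update i k c)) +
        ∑ l ∈ Finset.univ.erase k, ∑ c, A (i k) b * B (i l) c *
          T (Function.update (Function.update i k b) l c) := by
      intro b
      rw [← Finset.add_sum_erase Finset.univ _ (Finset.mem_univ k)]
      congr 1
      · simp [mul_assoc]
      · refine Finset.sum_congr rfl fun l hl => Finset.sum_congr rfl fun c _ => ?_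
        rw [Function.update_of_ne (Finset.ne_of_mem_erase hl), mul_assoc]
    simp only [h, Finset.sum_add_distrib]
    congr 1
    · rw [Finset.sum_comm]
      simp [Matrix.mul_apply, Finset.sum_mul]
    · rw [Finset.sum_comm]
  ext i
  rw [Pi.sub_apply, key, key, sub_der, Pi.sub_apply]
  have hs : (∑ k, ∑ l ∈ Finset.univ.erase k, ∑ b, ∑ c, A (i k) b * B (i l) c *
        T (Function.update (Function.update i k b) l c)) =
      ∑ k, ∑ l ∈ Finset.univ.erase k, ∑ b, ∑ c, B (i k) b * A (i l) c *
        T (Function.update (Function.update i k b) l c) := by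
    rw [Finset.sum_comm' (t' := Finset.univ) (s' := fun l => Finset.univ.erase l)
      (by intro a b; simp [eq_comm])]
    refine Finset.sum_congr rfl fun l _ => Finset.sum_congr rfl fun k hk => ?_
    rw [Finset.sum_comm]
    refine Finset.sum_congr rfl fun c _ => Finset.sum_congr rfl fun b _ => ?_
    rw [Function.update_comm (Finset.ne_of_mem_erase hk)]
    ring
  rw [hs]; ring

theorem act_succ (Z : Matrix (Fin n) (Fin n) ℝ) (T : Tens n (m + 1)) (i : Fin (m + 1) → Fin n) :
    act Z T i = ∑ c, Z (i (Fin.last m)) c * act Z (fun j => T (Fin.snoc j c)) (Fin.init i) := by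
  simp only [act]
  rw [← (Fin.snocEquiv (fun _ => Fin n)).sum_comp, Fintype.sum_prod_type]
  refine Finset.sum_congr rfl fun c _ => ?_
  rw [Finset.mul_sum]
  refine Finset.sum_congr rfl fun j _ => ?_
  simp only [Fin.snocEquiv, Equiv.coe_fn_mk, Fin.prod_univ_castSucc, Fin.snoc_castSucc,
    Fin.snoc_last, Fin.init]
  ring

theorem der_succ (A : Matrix (Fin n) (Fin n) ℝ) (T : Tens n (m + 1)) (i : Fin (m + 1) → Fin n) :
    der A T i = der A (fun j => T (Fin.snoc j (i (Fin.last m)))) (Fin.init i) +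
      ∑ b, A (i (Fin.last m)) b * T (Fin.snoc (Fin.init i) b) := by
  simp only [der, Fin.sum_univ_castSucc]
  congr 1
  · refine Finset.sum_congr rfl fun k _ => Finset.sum_congr rfl fun b _ => ?_
    congr 2
    conv_lhs => rw [← Fin.snoc_init_self i]
    rw [Fin.snoc_update]
  · refine Finset.sum_congr rfl fun b _ => ?_
    congr 2
    conv_lhs => rw [← Fin.snoc_init_self i]
    rw [Fin.update_snoc_last]

theorem act_zero_index (Z : Matrix (Fin n) (Fin n) ℝ) (T : Tens n 0) : act Z T = T := by
  ext i
  simp only [act, Finset.univ_eq_empty, Finset.prod_empty, one_mul]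
  rw [Fintype.sum_unique]
  congr 1
  exact Subsingleton.elim _ _

theorem act_four (Z : Matrix (Fin n) (Fin n) ℝ) (T : Tens n 4) (i : Fin 4 → Fin n) :
    act Z T i = ∑ s, Z (i 3) s * ∑ r, Z (i 2) r * ∑ q, Z (i 1) q * ∑ p, Z (i 0) p *
      T ![p, q, r, s] := by
  simp only [act_succ, act_zero_index]
  have : ∀ p q r s : Fin n, (Fin.snoc (Fin.snoc (Fin.snoc
      (Fin.snoc (fun k : Fin 0 => k.elim0) p) q) r) s :
      Fin 4 → Fin n) = ![p, q, r, s] := by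
    intro p q r s; ext k; fin_cases k <;> rfl
  refine Finset.sum_congr rfl fun s _ => ?_
  congr 1
  refine Finset.sum_congr rfl fun r _ => ?_
  congr 1
  refine Finset.sum_congr rfl fun q _ => ?_
  congr 1
  refine Finset.sum_congr rfl fun p _ => ?_
  rw [← this]
  congr 2

end Tens
end CurvHom
end

noncomputable section
namespace CurvHom
namespace MovingFrame

variable {n : ℕ} {M : Type*} [TopologicalSpace M] [ChartedSpace (EuclideanSpace ℝ (Fin n)) M]
  [IsManifold (𝓡 n) ∞ M] {η : Matrix (Fin n) (Fin n) ℝ} {g : Metric M η} {E E' : MovingFrame g}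
  {f h : M → ℝ} {x : M}

/-! ### The structure equations in terms of matrices -/

theorem bracketLow_swap (a b c : Fin n) : E.bracketLow a b c x = - E.bracketLow b a c x := by
  simp only [bracketLow]
  rw [VectorField.mlieBracket_swap_apply]
  simp

theorem connLow_swap (a b c : Fin n) : E.connLow a b c x = - E.connLow a c b x := by
  simp only [connLow]
  rw [bracketLow_swap a b c, bracketLow_swap b c a, bracketLow_swap c a b]
  ring

theorem connLow_sub (a b c : Fin n) :
    E.connLow a b c x - E.connLow b a c x = E.bracketLow a b c x := by
  simp only [connLow]
  rw [bracketLow_swap b a c, bracketLow_swap a c b, bracketLow_swap c b a]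
  ring

theorem conn_sub (a b c : Fin n) : E.conn a b c x - E.conn b a c x = E.bracket a b c x := by
  simp only [conn, bracket, ← Finset.sum_sub_distrib, ← mul_sub, connLow_sub]

/-- Uniqueness of the Levi-Civita connection: metric compatibility and vanishing torsion force the
Koszul formula. It identifies the connection after a change of frame. -/
theorem eq_connLow {C : Fin n → Fin n → Fin n → ℝ} (h1 : ∀ a b c, C a b c = - C a c b)
    (h2 : ∀ a b c, C a b c - C b a c = E.bracketLow a b c x) (a b c : Fin n) :
    C a b c = E.connLow a b c x := by
  simp only [connLow, ← h2]
  rw [h1 c b a, h1 a c b, h1 b c a]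
  ring

/-- The connection matrices: `∇_{E_a} E_b = ∑ c, connMat a b c • E_c`. -/
def connMat (E : MovingFrame g) (a : Fin n) (x : M) : Matrix (Fin n) (Fin n) ℝ :=
  Matrix.of fun b c => E.conn a b c x

/-- The connection matrices with the last index lowered. -/
def connLowMat (E : MovingFrame g) (a : Fin n) (x : M) : Matrix (Fin n) (Fin n) ℝ :=
  Matrix.of fun b c => E.connLow a b c x

/-- The entrywise derivative of a matrix of functions along a frame field. -/
def dirMat (E : MovingFrame g) (a : Fin n) (Z : M → Matrix (Fin n) (Fin n) ℝ) (x : M) :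
    Matrix (Fin n) (Fin n) ℝ :=
  Matrix.of fun b c => E.dir a (fun y => Z y b c) x

/-- The curvature matrices: `R(E_c, E_d) E_b = ∑ a, curvMat c d b a • E_a`. -/
def curvMat (E : MovingFrame g) (c d : Fin n) (x : M) : Matrix (Fin n) (Fin n) ℝ :=
  Matrix.of fun b a => E.riemUp a b c d x

/-- Entrywise smoothness of a matrix of functions on the domain of a moving frame. -/
def SmoothMat (E : MovingFrame g) (Z : M → Matrix (Fin n) (Fin n) ℝ) : Prop :=
  ∀ b c, E.Smooth (fun y => Z y b c)

theorem smoothMat_connMat (a : Fin n) : E.SmoothMat (E.connMat a) := fun b c => smooth_conn a b c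

theorem SmoothMat.mul {Z W : M → Matrix (Fin n) (Fin n) ℝ} (hZ : E.SmoothMat Z)
    (hW : E.SmoothMat W) : E.SmoothMat (fun y => Z y * W y) := fun b c => by
  simp only [Matrix.mul_apply]
  exact smooth_sum fun k _ => (hZ b k).mul (hW k c)

theorem SmoothMat.smul {φ : M → ℝ} {W : M → Matrix (Fin n) (Fin n) ℝ} (hφ : E.Smooth φ)
    (hW : E.SmoothMat W) : E.SmoothMat (fun y => φ y • W y) :=
  fun b c => hφ.mul (hW b c)

theorem SmoothMat.sum {ι : Type*} {s : Finset ι} {W : ι → M → Matrix (Fin n) (Fin n) ℝ}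
    (hW : ∀ i ∈ s, E.SmoothMat (W i)) : E.SmoothMat (fun y => ∑ i ∈ s, W i y) := fun b c => by
  simp only [Matrix.sum_apply]
  exact smooth_sum fun k hk => hW k hk b c

theorem SmoothMat.dirMat {Z : M → Matrix (Fin n) (Fin n) ℝ} (hZ : E.SmoothMat Z) (a : Fin n) :
    E.SmoothMat (E.dirMat a Z) := fun b c => (hZ b c).dir a

theorem dirMat_mul {Z W : M → Matrix (Fin n) (Fin n) ℝ} (a : Fin n) (hx : x ∈ E.U)
    (hZ : E.SmoothMat Z) (hW : E.SmoothMat W) :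
    E.dirMat a (fun y => Z y * W y) x = E.dirMat a Z x * W x + Z x * E.dirMat a W x := by
  ext b c
  simp only [dirMat, Matrix.of_apply, Matrix.mul_apply, Matrix.add_apply]
  rw [dir_sum a _ hx fun k _ => (hZ b k).mul (hW k c), ← Finset.sum_add_distrib]
  refine Finset.sum_congr rfl fun k _ => ?_
  rw [dir_mul a hx (hZ b k) (hW k c)]
  ring

theorem dirMat_add {Z W : M → Matrix (Fin n) (Fin n) ℝ} (a : Fin n) (hx : x ∈ E.U)
    (hZ : E.SmoothMat Z) (hW : E.SmoothMat W) :
    E.dirMat a (fun y => Z y + W y) x = E.dirMat a Z x + E.dirMat a W x := by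
  ext b c
  exact dir_add a hx (hZ b c) (hW b c)

theorem dirMat_smul {φ : M → ℝ} {W : M → Matrix (Fin n) (Fin n) ℝ} (a : Fin n) (hx : x ∈ E.U)
    (hφ : E.Smooth φ) (hW : E.SmoothMat W) :
    E.dirMat a (fun y => φ y • W y) x = φ x • E.dirMat a W x + E.dir a φ x • W x := by
  ext b c
  simp only [dirMat, Matrix.of_apply, Matrix.smul_apply, Matrix.add_apply, smul_eq_mul]
  rw [dir_mul a hx hφ (hW b c)]
  ring

theorem dirMat_sum {ι : Type*} {s : Finset ι} {W : ι → M → Matrix (Fin n) (Fin n) ℝ} (a : Fin n)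
    (hx : x ∈ E.U) (hW : ∀ i ∈ s, E.SmoothMat (W i)) :
    E.dirMat a (fun y => ∑ i ∈ s, W i y) x = ∑ i ∈ s, E.dirMat a (W i) x := by
  ext b c
  simp only [dirMat, Matrix.of_apply, Matrix.sum_apply]
  exact dir_sum a s hx fun k hk => hW k hk b c

theorem dirMat_congr {Z W : M → Matrix (Fin n) (Fin n) ℝ} (a : Fin n) (hx : x ∈ E.U)
    (h : ∀ y ∈ E.U, Z y = W y) : E.dirMat a Z x = E.dirMat a W x := by
  ext b c
  exact dir_congr a hx fun y hy => by rw [h y hy]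

theorem dirMat_const (a : Fin n) (W : Matrix (Fin n) (Fin n) ℝ) :
    E.dirMat a (fun _ => W) x = 0 := by
  ext b c
  exact dir_const a _

theorem smoothMat_const (W : Matrix (Fin n) (Fin n) ℝ) : E.SmoothMat (fun _ => W) :=
  fun _ _ => smooth_const _

theorem dirMat_transpose {Z : M → Matrix (Fin n) (Fin n) ℝ} (a : Fin n) :
    E.dirMat a (fun y => (Z y)ᵀ) x = (E.dirMat a Z x)ᵀ := rfl

/-- The matrices send a frame index (row) to an expansion (column), so composing covariant
derivatives multiplies them in the reverse order. -/
theorem curvMat_eq (c d : Fin n) :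
    E.curvMat c d x = E.dirMat c (E.connMat d) x - E.dirMat d (E.connMat c) x
      + (E.connMat d x * E.connMat c x - E.connMat c x * E.connMat d x)
      - ∑ f, E.bracket c d f x • E.connMat f x := by
  ext b a
  simp [curvMat, riemUp, dirMat, connMat, Matrix.mul_apply, Matrix.sum_apply]

theorem eta_transpose (E : MovingFrame g) (hx : x ∈ E.U) : ηᵀ = η := by
  ext a b; exact E.symm_of_mem hx b a

theorem connMat_mul_eta (hη : IsUnit η.det) (hx : x ∈ E.U) (a : Fin n) :
    E.connMat a x * η = E.connLowMat a x := by
  have h : E.connMat a x = E.connLowMat a x * η⁻¹ := by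
    ext b c
    simp only [connMat, connLowMat, conn, Matrix.of_apply, Matrix.mul_apply]
    refine Finset.sum_congr rfl fun d _ => ?_
    have : (η⁻¹)ᵀ = η⁻¹ := by rw [Matrix.transpose_nonsing_inv, E.eta_transpose hx]
    rw [mul_comm, ← this, Matrix.transpose_apply, this]
  rw [h, Matrix.mul_assoc, Matrix.nonsing_inv_mul _ hη, Matrix.mul_one]

theorem connMat_antisymm (hη : IsUnit η.det) (hx : x ∈ E.U) (a : Fin n) :
    E.connMat a x * η + η * (E.connMat a x)ᵀ = 0 := by
  have h : η * (E.connMat a x)ᵀ = (E.connMat a x * η)ᵀ := by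
    rw [Matrix.transpose_mul, E.eta_transpose hx]
  rw [h, connMat_mul_eta hη hx]
  ext b c
  simp only [connLowMat, Matrix.add_apply, Matrix.of_apply, Matrix.transpose_apply,
    Matrix.zero_apply]
  rw [connLow_swap]; ring

/-! ### Change of frame -/

/-- The matrix `Z` of functions such that `E'_a = ∑ b, Z a b • E_b`. -/
def transition (E E' : MovingFrame g) (x : M) : Matrix (Fin n) (Fin n) ℝ :=
  Matrix.of fun a b => ∑ c, η⁻¹ b c * g.val x (E'.vec a x) (E.vec c x)

theorem vec_eq_transition (hη : IsUnit η.det) (hx : x ∈ E.U) (a : Fin n) :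
    E'.vec a x = ∑ b, transition E E' x a b • E.vec b x :=
  E.expansion hη hx _

theorem transition_orth (hη : IsUnit η.det) (hx : x ∈ E.U) (hx' : x ∈ E'.U) :
    transition E E' x * η * (transition E E' x)ᵀ = η := by
  ext a b
  rw [← E'.orth a b x hx', vec_eq_transition hη hx a, vec_eq_transition hη hx b]
  simp only [Matrix.mul_apply, Matrix.transpose_apply, map_sum, map_smul, sum_apply,
    smul_apply, smul_eq_mul, E.orth _ _ x hx, Finset.sum_mul, Finset.mul_sum]
  refine Finset.sum_congr rfl fun c _ => Finset.sum_congr rfl fun d _ => ?_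
  ring

theorem smoothMat_transition (hU : E'.U = E.U) : E.SmoothMat (transition E E') := fun a b => by
  have h : ∀ c, E.Smooth (fun x => g.val x (E'.vec a x) (E.vec c x)) := fun c =>
    smooth_inner (hU ▸ E'.smooth a) (E.smooth c)
  have h2 : E.Smooth (fun x => ∑ c, η⁻¹ b c * g.val x (E'.vec a x) (E.vec c x)) :=
    smooth_sum fun c _ => (smooth_const (η⁻¹ b c)).mul (h c)
  exact h2

theorem dir_transition (hη : IsUnit η.det) (hx : x ∈ E.U) (a : Fin n) :
    E'.dir a f x = ∑ b, transition E E' x a b * E.dir b f x := by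
  rw [dir_eq, vec_eq_transition hη hx a, map_sum]
  exact Finset.sum_congr rfl fun b _ => map_smul (mvfderiv (𝓡 n) f x) _ _

theorem dirMat_transition (hη : IsUnit η.det) (hx : x ∈ E.U) (a : Fin n)
    (W : M → Matrix (Fin n) (Fin n) ℝ) :
    E'.dirMat a W x = ∑ b, transition E E' x a b • E.dirMat b W x := by
  ext c d
  simp only [dirMat, Matrix.of_apply, Matrix.sum_apply, Matrix.smul_apply, smul_eq_mul]
  exact dir_transition hη hx a

theorem mlieBracket_sum {ι : Type*} (s : Finset ι) {V : (x : M) → TangentSpace (𝓡 n) x}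
    {φ : ι → M → ℝ} {W : ι → (x : M) → TangentSpace (𝓡 n) x} (hx : x ∈ E.U)
    (hφ : ∀ i ∈ s, E.Smooth (φ i))
    (hW : ∀ i ∈ s, ContMDiffOn (𝓡 n) (𝓡 n).tangent ∞
      (fun x => (⟨x, W i x⟩ : TangentBundle (𝓡 n) M)) E.U) :
    VectorField.mlieBracket (𝓡 n) V (fun y => ∑ i ∈ s, φ i y • W i y) x =
      ∑ i ∈ s, (mvfderiv (𝓡 n) (φ i) x (V x) • W i x +
        φ i x • VectorField.mlieBracket (𝓡 n) V (W i) x) := by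
  classical
  have hmd : ∀ {V : (x : M) → TangentSpace (𝓡 n) x},
      ContMDiffOn (𝓡 n) (𝓡 n).tangent ∞ (fun x => (⟨x, V x⟩ : TangentBundle (𝓡 n) M)) E.U →
      MDifferentiableAt (𝓡 n) (𝓡 n).tangent
        (fun x => (⟨x, V x⟩ : TangentBundle (𝓡 n) M)) x := fun hV =>
    ((hV x hx).contMDiffAt (E.isOpen.mem_nhds hx)).mdifferentiableAt (by simp)
  induction s using Finset.induction_on with
  | empty =>
    simp only [Finset.sum_empty]
    exact congrFun (VectorField.mlieBracket_zero_right (I := 𝓡 n) (W := V)) x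
  | insert i s hi ih =>
    simp only [Finset.sum_insert hi]
    have h1 : ContMDiffOn (𝓡 n) (𝓡 n).tangent ∞
        (fun x => (⟨x, (φ i • W i) x⟩ : TangentBundle (𝓡 n) M)) E.U :=
      ContMDiffOn.smul_section (hφ i (by simp)) (hW i (by simp))
    have h2 : ContMDiffOn (𝓡 n) (𝓡 n).tangent ∞
        (fun x => (⟨x, ∑ j ∈ s, φ j x • W j x⟩ : TangentBundle (𝓡 n) M)) E.U :=
      ContMDiffOn.sum_section fun j hj =>
        ContMDiffOn.smul_section (hφ j (by simp [hj])) (hW j (by simp [hj]))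
    rw [← ih (fun j hj => hφ j (by simp [hj])) (fun j hj => hW j (by simp [hj]))]
    rw [← VectorField.mlieBracket_smul_right ((hφ i (by simp)).mdifferentiableAt hx)
      (hmd (hW i (by simp))), ← VectorField.mlieBracket_add_right (hmd h1) (hmd h2)]
    rfl

/-- The structure functions of a frame `E'` in terms of those of `E`. -/
theorem mlieBracket_transition (hη : IsUnit η.det) (hU : E'.U = E.U) (hx : x ∈ E.U)
    (a b : Fin n) :
    VectorField.mlieBracket (𝓡 n) (E'.vec a) (E'.vec b) x =
      ∑ e, (E'.dir a (fun y => transition E E' y b e) x - E'.dir b (fun y => transition E E' y a e) x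
        + ∑ c, ∑ d, transition E E' x a c * transition E E' x b d * E.bracket c d e x) •
          E.vec e x := by
  have hev : ∀ a, E'.vec a =ᶠ[nhds x] fun y => ∑ b, transition E E' y a b • E.vec b y := fun a =>
    Filter.eventuallyEq_of_mem (E.isOpen.mem_nhds hx) fun y hy => vec_eq_transition hη hy a
  refine (Filter.EventuallyEq.rfl.mlieBracket_vectorField_eq (hev b)).trans
    ((mlieBracket_sum Finset.univ (φ := fun d y => transition E E' y b d) (W := E.vec) hx
      (fun d _ => smoothMat_transition hU b d) (fun d _ => E.smooth d)).trans ?_)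
  have h1 : ∀ d, VectorField.mlieBracket (𝓡 n) (E'.vec a) (E.vec d) x =
      - ∑ c, (E.dir d (fun y => transition E E' y a c) x • E.vec c x +
        transition E E' x a c • ∑ e, E.bracket d c e x • E.vec e x) := by
    intro d
    rw [VectorField.mlieBracket_swap_apply]
    refine congrArg Neg.neg ((Filter.EventuallyEq.rfl.mlieBracket_vectorField_eq (hev a)).trans
      ((mlieBracket_sum Finset.univ (φ := fun d y => transition E E' y a d) (W := E.vec) hx
        (fun d _ => smoothMat_transition hU a d) (fun d _ => E.smooth d)).trans ?_))
    simp only [E.mlieBracket_vec hη hx]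
    rfl
  have hsw : ∀ c d e, E.bracket d c e x = - E.bracket c d e x := by
    intro c d e; rw [← conn_sub, ← conn_sub]; ring
  simp only [h1, Finset.sum_add_distrib, smul_neg, Finset.smul_sum, smul_add, smul_smul,
    Finset.sum_neg_distrib, add_smul, sub_smul, Finset.sum_smul, neg_add, Finset.sum_sub_distrib]
  have e1 : ∑ d, ∑ c, (transition E E' x b d * E.dir d (fun y => transition E E' y a c) x) •
      E.vec c x = ∑ c, E'.dir b (fun y => transition E E' y a c) x • E.vec c x := by
    rw [Finset.sum_comm]
    refine Finset.sum_congr rfl fun c _ => ?_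
    rw [dir_transition hη hx, Finset.sum_smul]
  have e2 : ∑ d, ∑ c, ∑ e, (transition E E' x b d * (transition E E' x a c * E.bracket d c e x)) •
      E.vec e x = - ∑ e, ∑ c, ∑ d, (transition E E' x a c * transition E E' x b d *
        E.bracket c d e x) • E.vec e x := by
    rw [Finset.sum_comm]
    conv_rhs => rw [Finset.sum_comm]
    rw [← Finset.sum_neg_distrib]
    refine Finset.sum_congr rfl fun c _ => ?_
    conv_rhs => rw [Finset.sum_comm]
    rw [← Finset.sum_neg_distrib]
    refine Finset.sum_congr rfl fun d _ => ?_
    rw [← Finset.sum_neg_distrib]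
    refine Finset.sum_congr rfl fun e _ => ?_
    rw [hsw, ← neg_smul]
    congr 1; ring
  rw [e1, e2]
  simp only [← dir_eq]
  abel

end MovingFrame
end CurvHom
end

/-! ### Transformation laws of the connection and the curvature. -/

noncomputable section
namespace CurvHom
namespace MovingFrame

variable {n : ℕ} {M : Type*} [TopologicalSpace M] [ChartedSpace (EuclideanSpace ℝ (Fin n)) M]
  [IsManifold (𝓡 n) ∞ M] {η : Matrix (Fin n) (Fin n) ℝ} {g : Metric M η} {E E' : MovingFrame g}
  {f h : M → ℝ} {x : M}

/-- The matrix of `∇_{E'_a}` on the frame `E`. -/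
def transConn (E E' : MovingFrame g) (a : Fin n) (x : M) : Matrix (Fin n) (Fin n) ℝ :=
  ∑ c, transition E E' x a c • E.connMat c x

theorem smoothMat_transConn (hU : E'.U = E.U) (a : Fin n) : E.SmoothMat (transConn E E' a) :=
  SmoothMat.sum fun c _ => SmoothMat.smul (smoothMat_transition hU a c) (smoothMat_connMat c)

theorem transition_orth' (hη : IsUnit η.det) (hx : x ∈ E.U) (hx' : x ∈ E'.U) :
    η * (transition E E' x)ᵀ * η⁻¹ * transition E E' x = 1 := by
  have h := transition_orth (E := E) (E' := E') hη hx hx'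
  have h2 : transition E E' x * (η * (transition E E' x)ᵀ * η⁻¹) = 1 := by
    rw [← Matrix.mul_assoc, ← Matrix.mul_assoc, h, Matrix.mul_nonsing_inv _ hη]
  exact mul_eq_one_comm.1 h2

/-- The transformation law of the connection matrices under a change of frame. -/
theorem connMat_transition (hη : IsUnit η.det) (hU : E'.U = E.U) (hx : x ∈ E.U) (a : Fin n) :
    E'.connMat a x * transition E E' x =
      E'.dirMat a (transition E E') x + transition E E' x * transConn E E' a x := by
  have hx' : x ∈ E'.U := hU ▸ hx
  set Z := transition E E' with hZ
  have hZs : E.SmoothMat Z := smoothMat_transition hU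
  -- The candidate for the lowered connection in the frame E', obtained by differentiating E'_b = ∑
  -- Z_bc E_c. By `eq_connLow` it suffices to check antisymmetry and torsion.
  let C : Fin n → Matrix (Fin n) (Fin n) ℝ := fun a =>
    (E'.dirMat a Z x + Z x * transConn E E' a x) * η * (Z x)ᵀ
  have hsymm := E.eta_transpose hx
  have h1 : ∀ a b c, C a b c = - C a c b := by
    intro a b c
    have hC : C a + (C a)ᵀ = 0 := by
      -- This is the derivative of the constant Z η Zᵀ = η.
      have e1 : E'.dirMat a Z x * η * (Z x)ᵀ + Z x * η * (E'.dirMat a Z x)ᵀ = 0 := by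
        have hconst : E'.dirMat a (fun y => (Z y * η) * (Z y)ᵀ) x = 0 := by
          rw [dirMat_congr (E := E') a hx' (W := fun _ => η), dirMat_const]
          intro y hy
          exact transition_orth hη (hU ▸ hy) hy
        have hZs' : E'.SmoothMat Z := fun b c => by
          have := hZs b c
          rwa [Smooth, ← hU] at this
        have hT : E'.SmoothMat (fun y => (Z y)ᵀ) := fun b c => hZs' c b
        rw [dirMat_mul (E := E') a hx' (hZs'.mul (smoothMat_const η)) hT,
          dirMat_mul (E := E') a hx' hZs' (smoothMat_const η), dirMat_const,
          dirMat_transpose] at hconst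
        simpa using hconst
      have e2 : transConn E E' a x * η + η * (transConn E E' a x)ᵀ = 0 := by
        simp only [transConn, Matrix.transpose_sum, Matrix.sum_mul, Matrix.mul_sum,
          Matrix.transpose_smul, Matrix.smul_mul, Matrix.mul_smul, ← Finset.sum_add_distrib,
          ← smul_add, connMat_antisymm hη hx, smul_zero, Finset.sum_const_zero]
      have e3 : Z x * (transConn E E' a x * η + η * (transConn E E' a x)ᵀ) * (Z x)ᵀ = 0 := by
        rw [e2]; simp
      simp only [C, Matrix.transpose_mul, Matrix.transpose_add, Matrix.transpose_transpose, hsymm]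
      rw [← add_zero (0 : Matrix (Fin n) (Fin n) ℝ)]
      nth_rewrite 1 [← e1]
      rw [← e3]
      simp only [Matrix.mul_add, Matrix.add_mul, Matrix.mul_assoc]
      abel
    have := congrFun (congrFun hC b) c
    simp only [Matrix.add_apply, Matrix.transpose_apply, Matrix.zero_apply] at this
    linarith
  have h2 : ∀ a b c, C a b c - C b a c = E'.bracketLow a b c x := by
    intro a b c
    have hw : ∀ a b e, (E'.dirMat a Z x + Z x * transConn E E' a x) b e =
        E'.dir a (fun y => Z y b e) x + ∑ c, ∑ d, Z x a c * Z x b d * E.conn c d e x := by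
      intro a b e
      simp only [Matrix.add_apply, dirMat, Matrix.of_apply, Matrix.mul_apply, transConn,
        Matrix.sum_apply, Matrix.smul_apply, smul_eq_mul, connMat, Finset.mul_sum]
      congr 1
      refine Finset.sum_congr rfl fun c _ => Finset.sum_congr rfl fun d _ => ?_
      rw [← hZ]; ring
    have hbr : E'.bracketLow a b c x = ∑ e, ((E'.dirMat a Z x + Z x * transConn E E' a x) b e -
        (E'.dirMat b Z x + Z x * transConn E E' b x) a e) * (η * (Z x)ᵀ) e c := by
      have hg : ∀ e, g.val x (E.vec e x) (E'.vec c x) = (η * (Z x)ᵀ) e c := by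
        intro e
        rw [vec_eq_transition (E := E) hη hx c]
        simp only [map_sum, map_smul, smul_eq_mul, E.orth _ _ x hx, Matrix.mul_apply,
          Matrix.transpose_apply]
        exact Finset.sum_congr rfl fun f _ => mul_comm _ _
      rw [bracketLow, mlieBracket_transition hη hU hx]
      simp only [map_sum, map_smul, sum_apply, smul_apply, smul_eq_mul, hg]
      refine Finset.sum_congr rfl fun e _ => ?_
      rw [hw, hw]
      congr 1
      have : ∑ c, ∑ d, Z x b c * Z x a d * E.conn c d e x =
          ∑ c, ∑ d, Z x a c * Z x b d * E.conn d c e x := by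
        rw [Finset.sum_comm]
        refine Finset.sum_congr rfl fun c _ => Finset.sum_congr rfl fun d _ => ?_
        ring
      rw [this, add_sub_add_comm, ← Finset.sum_sub_distrib]
      congr 1
      refine Finset.sum_congr rfl fun c _ => ?_
      rw [← Finset.sum_sub_distrib]
      refine Finset.sum_congr rfl fun d _ => ?_
      rw [← conn_sub, mul_sub]
    rw [hbr]
    simp only [C, Matrix.mul_assoc _ η, Matrix.mul_apply (M := _ + _), sub_mul,
      Finset.sum_sub_distrib]
  have h3 : E'.connLowMat a x = C a := by
    ext b c
    exact (eq_connLow h1 h2 a b c).symm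
  have h4 : E'.connMat a x = C a * η⁻¹ := by
    rw [← h3, ← connMat_mul_eta hη hx', Matrix.mul_assoc, Matrix.mul_nonsing_inv _ hη,
      Matrix.mul_one]
  rw [h4]
  have h5 := transition_orth' (E := E) (E' := E') hη hx hx'
  simp only [C, Matrix.mul_assoc] at h5 ⊢
  rw [← hZ] at h5
  rw [h5, Matrix.mul_one]

theorem bracket_transition (hη : IsUnit η.det) (hU : E'.U = E.U) (hx : x ∈ E.U) (a b e : Fin n) :
    ∑ c, E'.bracket a b c x * transition E E' x c e =
      E'.dir a (fun y => transition E E' y b e) x - E'.dir b (fun y => transition E E' y a e) x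
        + ∑ c, ∑ d, transition E E' x a c * transition E E' x b d * E.bracket c d e x := by
  have h := mlieBracket_transition hη hU hx a b
  rw [E'.mlieBracket_vec hη (hU ▸ hx)] at h
  simp only [vec_eq_transition (E := E) (E' := E') hη hx, Finset.smul_sum, smul_smul] at h
  rw [Finset.sum_comm] at h
  simp only [← Finset.sum_smul] at h
  have h2 := sub_eq_zero.2 h
  rw [← Finset.sum_sub_distrib] at h2
  simp only [← sub_smul] at h2
  exact sub_eq_zero.1 (Fintype.linearIndependent_iff.1 (E.linearIndependent_vec hη hx) _ h2 e)

/-- The curvature is a tensor. -/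
theorem curvMat_transition (hη : IsUnit η.det) (hU : E'.U = E.U) (hx : x ∈ E.U) (a b : Fin n) :
    E'.curvMat a b x * transition E E' x = transition E E' x *
      ∑ c, ∑ d, (transition E E' x a c * transition E E' x b d) • E.curvMat c d x := by
  have hx' : x ∈ E'.U := hU ▸ hx
  set Z := transition E E' with hZ
  have hsm : ∀ {W}, E.SmoothMat W → E'.SmoothMat W := fun hW b c => by
    have := hW b c
    rwa [Smooth, ← hU] at this
  have hZs : E'.SmoothMat Z := hsm (smoothMat_transition hU)
  have hD : ∀ a, E'.SmoothMat (transConn E E' a) := fun a => hsm (smoothMat_transConn hU a)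
  -- The connection law, differentiated once more. On antisymmetrizing in `a` and `b`, the mixed
  -- terms ∂Z · `transConn` cancel and the second derivatives of Z leave a bracket term.
  have key : ∀ a b, E'.dirMat a (E'.connMat b) x * Z x + E'.connMat b x * E'.connMat a x * Z x =
      E'.dirMat a (E'.dirMat b Z) x + E'.dirMat a Z x * transConn E E' b x
        + E'.dirMat b Z x * transConn E E' a x
        + Z x * (E'.dirMat a (transConn E E' b) x + transConn E E' b x * transConn E E' a x) := by
    intro a b
    have h1 := dirMat_congr (E := E') a hx'
      (fun y hy => connMat_transition (E := E) (E' := E') hη hU (hU ▸ hy) b)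
    rw [dirMat_mul a hx' (smoothMat_connMat b) hZs,
      dirMat_add a hx' (hZs.dirMat b) (hZs.mul (hD b)), dirMat_mul a hx' hZs (hD b)] at h1
    have h2 := connMat_transition (E := E) (E' := E') hη hU hx a
    have h3 := connMat_transition (E := E) (E' := E') hη hU hx b
    rw [← hZ] at h2 h3
    have h4 : E'.connMat b x * E'.connMat a x * Z x = E'.connMat b x * E'.dirMat a Z x
        + (E'.dirMat b Z x + Z x * transConn E E' b x) * transConn E E' a x := by
      rw [← h3, Matrix.mul_assoc, h2, Matrix.mul_add, Matrix.mul_assoc]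
    rw [h4, ← add_assoc, h1]
    simp only [Matrix.add_mul, Matrix.mul_add, Matrix.mul_assoc]
    abel
  have hcomm : E'.dirMat a (E'.dirMat b Z) x - E'.dirMat b (E'.dirMat a Z) x =
      ∑ f, E'.bracket a b f x • E'.dirMat f Z x := by
    ext i j
    simp only [dirMat, Matrix.sub_apply, Matrix.of_apply, Matrix.sum_apply, Matrix.smul_apply,
      smul_eq_mul]
    exact dir_comm hη a b hx' (hZs i j)
  have hC : (∑ f, E'.bracket a b f x • E'.connMat f x) * Z x =
      (∑ f, E'.bracket a b f x • E'.dirMat f Z x)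
        + Z x * ∑ f, E'.bracket a b f x • transConn E E' f x := by
    simp only [Matrix.sum_mul, Matrix.mul_sum, Matrix.smul_mul, Matrix.mul_smul,
      ← Finset.sum_add_distrib, ← smul_add]
    exact Finset.sum_congr rfl fun f _ => by rw [connMat_transition (E := E) hη hU hx]
  have hdD : ∀ a b, E'.dirMat a (transConn E E' b) x =
      (∑ d, E'.dir a (fun y => Z y b d) x • E.connMat d x)
        + ∑ c, ∑ d, (Z x a c * Z x b d) • E.dirMat c (E.connMat d) x := by
    intro a b
    rw [dirMat_transition (E := E) hη hx]
    have : ∀ c, E.dirMat c (fun x => ∑ d, transition E E' x b d • E.connMat d x) x =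
        (∑ d, E.dir c (fun y => Z y b d) x • E.connMat d x)
          + ∑ d, Z x b d • E.dirMat c (E.connMat d) x := by
      intro c
      rw [dirMat_sum c hx fun d _ => SmoothMat.smul (smoothMat_transition hU b d)
        (smoothMat_connMat d), ← Finset.sum_add_distrib]
      refine Finset.sum_congr rfl fun d _ => ?_
      rw [dirMat_smul c hx (smoothMat_transition hU b d) (smoothMat_connMat d), add_comm]
    have e : ∀ c, E.dirMat c (fun x => ∑ d, transition E E' x b d • E.connMat d x) x =
      E.dirMat c (transConn E E' b) x := fun c => rfl
    simp only [← e, this, smul_add, Finset.sum_add_distrib, Finset.smul_sum, smul_smul]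
    congr 1
    rw [Finset.sum_comm]
    refine Finset.sum_congr rfl fun d _ => ?_
    rw [dir_transition (E := E) hη hx, Finset.sum_smul]
  -- The curvature of the pulled-back connection `transConn`. The derivatives of Z cancel against
  -- those in the brackets of E', which leaves a bilinear expression in Z.
  have hmain : E'.dirMat a (transConn E E' b) x - E'.dirMat b (transConn E E' a) x
      + (transConn E E' b x * transConn E E' a x - transConn E E' a x * transConn E E' b x)
      - ∑ f, E'.bracket a b f x • transConn E E' f x =
      ∑ c, ∑ d, (Z x a c * Z x b d) • E.curvMat c d x := by
    have hbr : ∑ f, E'.bracket a b f x • transConn E E' f x =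
        (∑ d, E'.dir a (fun y => Z y b d) x • E.connMat d x)
          - (∑ d, E'.dir b (fun y => Z y a d) x • E.connMat d x)
          + ∑ e, ∑ c, ∑ d, (Z x a c * Z x b d * E.bracket c d e x) • E.connMat e x := by
      simp only [transConn, Finset.smul_sum, smul_smul]
      rw [Finset.sum_comm]
      simp only [← Finset.sum_smul]
      simp only [bracket_transition hη hU hx, add_smul, sub_smul, Finset.sum_add_distrib,
        Finset.sum_sub_distrib, hZ]
    have hq : ∀ a b, transConn E E' b x * transConn E E' a x =
        ∑ c, ∑ d, (Z x a c * Z x b d) • (E.connMat d x * E.connMat c x) := by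
      intro a b
      simp only [transConn, Matrix.sum_mul, Matrix.mul_sum, Matrix.smul_mul, Matrix.mul_smul,
        Finset.smul_sum, smul_smul, hZ]
    have hsw : ∀ F : Fin n → Fin n → Matrix (Fin n) (Fin n) ℝ,
        ∑ c, ∑ d, (Z x b c * Z x a d) • F c d = ∑ c, ∑ d, (Z x a c * Z x b d) • F d c := by
      intro F
      rw [Finset.sum_comm]
      refine Finset.sum_congr rfl fun c _ => Finset.sum_congr rfl fun d _ => ?_
      rw [mul_comm]
    have h3 : ∑ e, ∑ c, ∑ d, (Z x a c * Z x b d * E.bracket c d e x) • E.connMat e x =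
        ∑ c, ∑ d, (Z x a c * Z x b d) • ∑ e, E.bracket c d e x • E.connMat e x := by
      rw [Finset.sum_comm]
      refine Finset.sum_congr rfl fun c _ => ?_
      rw [Finset.sum_comm]
      refine Finset.sum_congr rfl fun d _ => ?_
      rw [Finset.smul_sum]
      exact Finset.sum_congr rfl fun e _ => by rw [smul_smul]
    rw [hbr, hdD, hdD, hq, hq, hsw, hsw, h3]
    simp only [curvMat_eq, smul_sub, smul_add, Finset.sum_add_distrib, Finset.sum_sub_distrib]
    abel
  rw [← hmain, curvMat_eq]
  have k1 := key a b
  have k2 := key b a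
  rw [Matrix.sub_mul, Matrix.add_mul, Matrix.sub_mul, Matrix.sub_mul, hC, ← hcomm]
  rw [Matrix.mul_sub, Matrix.mul_add, Matrix.mul_sub, Matrix.mul_sub]
  rw [Matrix.mul_add] at k1 k2
  rw [← sub_eq_zero]
  have := congrArg₂ (· - ·) (sub_eq_zero.2 k1) (sub_eq_zero.2 k2)
  simp only [sub_zero] at this
  rw [← this]
  abel

end MovingFrame
end CurvHom
end

/-! ### Tensor character of the iterated covariant derivatives of R. -/

noncomputable section
namespace CurvHom
namespace MovingFrame

variable {n : ℕ} {M : Type*} [TopologicalSpace M] [ChartedSpace (EuclideanSpace ℝ (Fin n)) M]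
  [IsManifold (𝓡 n) ∞ M] {η : Matrix (Fin n) (Fin n) ℝ} {g : Metric M η} {E E' : MovingFrame g}
  {f h : M → ℝ} {x : M} {m : ℕ}

open Tens

/-- The componentwise derivative of a tensor-valued function along a frame field. -/
def dirTens (E : MovingFrame g) (a : Fin n) (T : M → Tens n m) (x : M) : Tens n m :=
  fun i => E.dir a (fun y => T y i) x

theorem covDeriv_apply (T : M → Tens n m) (i : Fin (m + 1) → Fin n) :
    E.covDeriv T x i = E.dirTens (i (Fin.last m)) T x (Fin.init i) -
      der (E.connMat (i (Fin.last m)) x) (T x) (Fin.init i) := rfl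

theorem covDeriv_snoc (T : M → Tens n m) (i : Fin m → Fin n) (a : Fin n) :
    E.covDeriv T x (Fin.snoc i a) = (E.dirTens a T x - der (E.connMat a x) (T x)) i := by
  rw [covDeriv_apply]
  simp only [Fin.snoc_last, Fin.init_snoc, Pi.sub_apply]

theorem riem_eq_curvMat (hx : x ∈ E.U) (i : Fin 4 → Fin n) :
    E.riem x i = (E.curvMat (i 2) (i 3) x * η) (i 1) (i 0) := by
  simp only [riem, curvMat, Matrix.mul_apply, Matrix.of_apply]
  exact Finset.sum_congr rfl fun e _ => by rw [E.symm_of_mem hx, mul_comm]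

theorem riem_transition (hη : IsUnit η.det) (hU : E'.U = E.U) (hx : x ∈ E.U) :
    E'.riem x = act (transition E E' x) (E.riem x) := by
  have hx' : x ∈ E'.U := hU ▸ hx
  ext i
  have h := curvMat_transition hη hU hx (i 2) (i 3)
  set Z := transition E E' x with hZ
  have h2 : E'.curvMat (i 2) (i 3) x * η =
      ∑ c, ∑ d, (Z (i 2) c * Z (i 3) d) • (Z * (E.curvMat c d x * η) * Zᵀ) := by
    refine (congrArg (E'.curvMat (i 2) (i 3) x * ·) (transition_orth (E := E) hη hx hx')).symm.trans
      ?_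
    rw [← hZ, Matrix.mul_assoc Z, ← Matrix.mul_assoc, h]
    simp only [Matrix.mul_sum, Matrix.sum_mul, Matrix.mul_smul, Matrix.smul_mul, Matrix.mul_assoc]
  rw [riem_eq_curvMat hx', h2, act_four]
  simp only [riem_eq_curvMat hx, Matrix.sum_apply, Matrix.smul_apply, smul_eq_mul,
    Matrix.mul_apply (M := _ * _) (N := Zᵀ), Matrix.mul_apply (M := Z), Matrix.transpose_apply,
    Finset.mul_sum, Finset.sum_mul]
  rw [Finset.sum_comm]
  refine Finset.sum_congr rfl fun s _ => Finset.sum_congr rfl fun r _ => ?_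
  rw [Finset.sum_comm]
  refine Finset.sum_congr rfl fun q _ => Finset.sum_congr rfl fun p _ => ?_
  simp only [Matrix.cons_val]
  ring

/-- Differentiating `act Z T` produces an inhomogeneous term in ∂Z. The connection law produces the
same term, and the two cancel. -/
theorem covDeriv_transition (hη : IsUnit η.det) (hU : E'.U = E.U) (hx : x ∈ E.U)
    {T T' : M → Tens n m} (hT : ∀ i, E.Smooth (fun y => T y i))
    (h : ∀ y ∈ E.U, T' y = act (transition E E' y) (T y)) :
    E'.covDeriv T' x = act (transition E E' x) (E.covDeriv T x) := by
  have hx' : x ∈ E'.U := hU ▸ hx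
  have hsm : ∀ {φ}, E.Smooth φ → E'.Smooth φ := fun h => by rwa [Smooth, ← hU] at h
  set Z := transition E E' with hZ
  have hZs : ∀ a b, E'.Smooth (fun y => Z y a b) := fun a b => hsm (smoothMat_transition hU a b)
  have hd : ∀ a, E'.dirTens a T' x =
      dact (Z x) (E'.dirMat a Z x) (T x) + act (Z x) (E'.dirTens a T x) := by
    intro a
    ext i
    simp only [dirTens]
    rw [dir_congr (E := E') a hx' (h := fun y => ∑ j : Fin m → Fin n, (∏ k, Z y (i k) (j k)) * T y j)
      (fun y hy => by rw [h y (hU ▸ hy)]; rfl)]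
    rw [dir_sum a _ hx' fun j _ => (smooth_prod fun k _ => hZs _ _).mul (hsm (hT j))]
    simp only [Pi.add_apply, dact, act, ← Finset.sum_add_distrib]
    refine Finset.sum_congr rfl fun j _ => ?_
    rw [dir_mul a hx' (smooth_prod fun k _ => hZs _ _) (hsm (hT j)), add_comm]
    congr 1
    rw [mul_comm]
    congr 1
    have hprod : ∀ s : Finset (Fin m), E'.dir a (fun y => ∏ k ∈ s, Z y (i k) (j k)) x =
        ∑ k ∈ s, E'.dirMat a Z x (i k) (j k) * ∏ k' ∈ s.erase k, Z x (i k') (j k') := by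
      intro s
      induction s using Finset.induction_on with
      | empty => simp [dir_const]
      | insert k s hk ih =>
        simp only [Finset.prod_insert hk]
        rw [dir_mul a hx' (hZs _ _) (smooth_prod fun k _ => hZs _ _), ih, Finset.sum_insert hk,
          Finset.erase_insert hk, Finset.mul_sum, add_comm]
        congr 1
        · rw [mul_comm]; rfl
        · refine Finset.sum_congr rfl fun k' hk' => ?_
          have hne : k' ≠ k := fun e => hk (e ▸ hk')
          rw [Finset.erase_insert_of_ne hne.symm, Finset.prod_insert (by simp [hk])]
          ring
    exact hprod _
  have hd2 : ∀ a, E'.dirTens a T x = ∑ c, Z x a c • E.dirTens c T x := by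
    intro a
    ext i
    simp only [dirTens, Finset.sum_apply, Pi.smul_apply, smul_eq_mul]
    exact dir_transition hη hx a
  have hg : ∀ a, der (E'.connMat a x) (T' x) =
      dact (Z x) (E'.dirMat a Z x) (T x) + act (Z x) (∑ c, Z x a c • der (E.connMat c x) (T x)) := by
    intro a
    rw [h x hx, der_act, connMat_transition hη hU hx, dact_add, ← act_der, transConn, sum_der]
    simp only [smul_der]
    rfl
  ext i
  rw [covDeriv_apply, hd, hg, act_succ]
  have e : ∀ c, (fun j => E.covDeriv T x (Fin.snoc j c)) =
      E.dirTens c T x - der (E.connMat c x) (T x) := fun c => funext fun j => covDeriv_snoc T j c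
  simp only [e, hd2, Pi.add_apply, act_sub, act_sum, act_smul, Finset.sum_apply,
    Pi.smul_apply, Pi.sub_apply, smul_eq_mul,
    mul_sub, Finset.sum_sub_distrib]
  ring

theorem riemDeriv_transition (hη : IsUnit η.det) (hU : E'.U = E.U) (k : ℕ) (hx : x ∈ E.U) :
    E'.riemDeriv k x = act (transition E E' x) (E.riemDeriv k x) := by
  induction k generalizing x with
  | zero => exact riem_transition hη hU hx
  | succ k ih => exact covDeriv_transition hη hU hx (smooth_riemDeriv k) fun y hy => ih hy

/-- The restriction of a moving frame to a smaller domain. -/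
def restrict (E : MovingFrame g) {V : Set M} (hV : IsOpen V) : MovingFrame g where
  U := E.U ∩ V
  isOpen := E.isOpen.inter hV
  vec := E.vec
  smooth a := (E.smooth a).mono Set.inter_subset_left
  orth a b x hx := E.orth a b x hx.1

theorem riemDeriv_restrict (E : MovingFrame g) {V : Set M} (hV : IsOpen V) (k : ℕ) :
    (E.restrict hV).riemDeriv k = E.riemDeriv k := by
  induction k with
  | zero => rfl
  | succ k ih =>
    change (E.restrict hV).covDeriv ((E.restrict hV).riemDeriv k) = _
    rw [ih]; rfl

/-- The components of the curvature and its covariant derivatives are those of tensors. -/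
theorem exists_riemDeriv_eq_act (E E' : MovingFrame g) (hη : IsUnit η.det) (hx : x ∈ E.U)
    (hx' : x ∈ E'.U) : ∃ Z : Matrix (Fin n) (Fin n) ℝ, Z * η * Zᵀ = η ∧
      (∀ a, E'.vec a x = ∑ b, Z a b • E.vec b x) ∧
      ∀ k, E'.riemDeriv k x = act Z (E.riemDeriv k x) := by
  refine ⟨transition E E' x, transition_orth hη hx hx', vec_eq_transition hη hx, fun k => ?_⟩
  -- The transformation laws compare frames with equal domains, so both frames are restricted to the
  -- intersection.
  have hU : (E'.restrict E.isOpen).U = (E.restrict E'.isOpen).U := Set.inter_comm _ _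
  have := riemDeriv_transition hη hU k (show x ∈ (E.restrict E'.isOpen).U from ⟨hx, hx'⟩)
  rwa [riemDeriv_restrict, riemDeriv_restrict] at this

end MovingFrame
end CurvHom
end

/-! ### The lifted rank as the dimension of an explicit span. -/

noncomputable section
namespace CurvHom

variable {n : ℕ} {M : Type*} [TopologicalSpace M] [ChartedSpace (EuclideanSpace ℝ (Fin n)) M]
  [IsManifold (𝓡 n) ∞ M] {η : Matrix (Fin n) (Fin n) ℝ} {g : Metric M η}
  {f h : M → ℝ} {x : M} {m p : ℕ}

open Tens

/-- The derivation `Tens.der` on each component. -/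
def curvDer (B : Matrix (Fin n) (Fin n) ℝ) (T : CurvSpace n p) : CurvSpace n p :=
  fun k => der B (T k)

theorem curvAct_one (T : CurvSpace n p) : curvAct 1 T = T := by
  ext k : 1
  simp [curvAct, tensAct_eq_act, act_one]

theorem hasDerivAt_exp_entry (A : Matrix (Fin n) (Fin n) ℝ) (i j : Fin n) :
    HasDerivAt (fun t : ℝ => (NormedSpace.exp (t • A)) i j) (A i j) 0 := by
  let _ : NormedRing (Matrix (Fin n) (Fin n) ℝ) := Matrix.linftyOpNormedRing
  let _ : NormedAlgebra ℝ (Matrix (Fin n) (Fin n) ℝ) := Matrix.linftyOpNormedAlgebra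
  have h := hasDerivAt_exp_smul_const (𝕂 := ℝ) A (0 : ℝ)
  simp only [zero_smul, NormedSpace.exp_zero, one_mul] at h
  have := hasDerivAt_pi.1 (hasDerivAt_pi.1 h i) j
  exact this

theorem hasDerivAt_exp_inv_entry (A : Matrix (Fin n) (Fin n) ℝ) (i j : Fin n) :
    HasDerivAt (fun t : ℝ => (NormedSpace.exp (t • A))⁻¹ i j) (- A i j) 0 := by
  have h := hasDerivAt_exp_entry (-A) i j
  refine h.congr_of_eventuallyEq (Filter.Eventually.of_forall fun t => ?_)
  simp only
  rw [smul_neg, Matrix.exp_neg]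

/-- The action uses X⁻¹ with its row index contracted, so the generator A acts through -Aᵀ. This is
why `frameAlgebra` is the transpose of `orthAlgebra`. -/
theorem hasDerivAt_tensAct_exp (A : Matrix (Fin n) (Fin n) ℝ) (T : Tens n m) (i : Fin m → Fin n) :
    HasDerivAt (fun t : ℝ => tensAct (NormedSpace.exp (t • A)) T i) (der (-Aᵀ) T i) 0 := by
  rw [← dact_one]
  simp only [tensAct, dact]
  refine HasDerivAt.fun_sum fun j _ => HasDerivAt.mul_const ?_ _
  have h := HasDerivAt.fun_finsetProd (u := Finset.univ) (x := (0 : ℝ))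
    (f := fun (k : Fin m) (t : ℝ) => (NormedSpace.exp (t • A))⁻¹ (j k) (i k))
    (f' := fun k => - A (j k) (i k)) fun k _ => hasDerivAt_exp_inv_entry A (j k) (i k)
  convert h using 1
  refine Finset.sum_congr rfl fun k _ => ?_
  rw [smul_eq_mul, mul_comm]
  congr 1
  refine Finset.prod_congr rfl fun k' _ => ?_
  simp [Matrix.one_apply, eq_comm]

theorem hasDerivAt_curvAct_exp (A : Matrix (Fin n) (Fin n) ℝ) (T : CurvSpace n p) :
    HasDerivAt (fun t : ℝ => curvAct (NormedSpace.exp (t • A)) T) (curvDer (-Aᵀ) T) 0 :=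
  hasDerivAt_pi.2 fun k => hasDerivAt_pi.2 fun i => hasDerivAt_tensAct_exp A (T k) i

/-- The matrices `B` such that `der B` is an infinitesimal orthogonal change of frame. -/
def frameAlgebra (η : Matrix (Fin n) (Fin n) ℝ) : Set (Matrix (Fin n) (Fin n) ℝ) :=
  {B | B * η + η * Bᵀ = 0}

theorem neg_transpose_mem_frameAlgebra {A : Matrix (Fin n) (Fin n) ℝ} :
    -Aᵀ ∈ frameAlgebra η ↔ A ∈ orthAlgebra η := by
  simp only [frameAlgebra, orthAlgebra, Set.mem_ofPred_eq, Matrix.neg_mul, Matrix.transpose_neg,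
    Matrix.transpose_transpose, Matrix.mul_neg]
  rw [← neg_add, neg_eq_zero]

namespace MovingFrame
variable {E E' : MovingFrame g}

/-- The derivative of `E.curv p` along the frame field `E_a`. -/
def dirCurv (E : MovingFrame g) (p : ℕ) (a : Fin n) (x : M) : CurvSpace n p :=
  fun k => E.dirTens a (E.riemDeriv k) x

theorem mdifferentiableAt_curv (hx : x ∈ E.U) :
    MDifferentiableAt (𝓡 n) 𝓘(ℝ, CurvSpace n p) (E.curv p) x := by
  have : ContMDiffAt (𝓡 n) 𝓘(ℝ, CurvSpace n p) ∞ (E.curv p) x :=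
    contMDiffAt_pi_space.2 fun k => contMDiffAt_pi_space.2 fun i =>
      (smooth_riemDeriv (k : ℕ) i).contMDiffAt hx
  exact this.mdifferentiableAt (by simp)

theorem mfderiv_curv_vec (hx : x ∈ E.U) (a : Fin n) :
    (mfderiv (𝓡 n) 𝓘(ℝ, CurvSpace n p) (E.curv p) x (E.vec a x) : CurvSpace n p) =
      E.dirCurv p a x := by
  refine funext fun k => funext fun i => ?_
  let L : CurvSpace n p →L[ℝ] ℝ :=
    (ContinuousLinearMap.proj i).comp
      (ContinuousLinearMap.proj (R := ℝ) (φ := fun k : Fin (p + 1) => Tens n (4 + (k : ℕ))) k)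
  have h := mfderiv_comp x (I'' := 𝓘(ℝ, ℝ)) (L.differentiableAt.mdifferentiableAt (x := E.curv p x))
    (mdifferentiableAt_curv (p := p) hx)
  rw [mfderiv_eq_fderiv, L.fderiv] at h
  exact (congrArg (fun F => F (E.vec a x)) h).symm

/-- Full regularity makes the rank the same at every coframe, so only X = 1 is ever evaluated.
There, horizontal directions become frame derivatives and vertical directions become derivations. -/
theorem liftRankAt_one (hη : IsUnit η.det) (hx : x ∈ E.U) :
    E.liftRankAt p x 1 = Module.finrank ℝ (Submodule.span ℝ
      (Set.range (fun a => E.dirCurv p a x) ∪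
        {w | ∃ B ∈ frameAlgebra η, w = curvDer B (E.curv p x)})) := by
  have h1 : {w : CurvSpace n p | ∃ A ∈ orthAlgebra η,
      w = deriv (fun t : ℝ => curvAct (NormedSpace.exp (t • A) * 1) (E.curv p x)) 0} =
      {w | ∃ B ∈ frameAlgebra η, w = curvDer B (E.curv p x)} := by
    ext w
    constructor
    · rintro ⟨A, hA, rfl⟩
      refine ⟨-Aᵀ, (neg_transpose_mem_frameAlgebra).2 hA, ?_⟩
      simp only [mul_one]
      exact (hasDerivAt_curvAct_exp A _).deriv
    · rintro ⟨B, hB, rfl⟩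
      refine ⟨-Bᵀ, (neg_transpose_mem_frameAlgebra).1 (by simpa using hB), ?_⟩
      simp only [mul_one]
      rw [(hasDerivAt_curvAct_exp (-Bᵀ) _).deriv]
      simp
  -- The type of `mfderiv` depends on the value of the map at `x`, so the map is generalized before
  -- identifying `curvAct 1` with the identity.
  have hF : ∀ F : M → CurvSpace n p, F = E.curv p → ∀ a,
      (mfderiv (𝓡 n) 𝓘(ℝ, CurvSpace n p) F x (E.vec a x) : CurvSpace n p) = E.dirCurv p a x := by
    rintro _ rfl a; exact mfderiv_curv_vec hx a
  let D : TangentSpace (𝓡 n) x →ₗ[ℝ] CurvSpace n p :=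
    (mfderiv (𝓡 n) 𝓘(ℝ, CurvSpace n p) (fun y => curvAct 1 (E.curv p y)) x).toLinearMap
  have hD : ∀ a, D (E.vec a x) = E.dirCurv p a x := hF _ (funext fun y => curvAct_one _)
  have hlift : E.liftRankAt p x 1 = Module.finrank ℝ (Submodule.span ℝ (Set.range D ∪
      {w : CurvSpace n p | ∃ A ∈ orthAlgebra η,
        w = deriv (fun t : ℝ => curvAct (NormedSpace.exp (t • A) * 1) (E.curv p x)) 0})) := rfl
  have h2 : Submodule.span ℝ (Set.range D) =
      Submodule.span ℝ (Set.range (fun a => E.dirCurv p a x)) := by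
    apply le_antisymm
    · rw [Submodule.span_le]
      rintro _ ⟨v, rfl⟩
      rw [SetLike.mem_coe, E.expansion hη hx v, map_sum]
      refine Submodule.sum_mem _ fun c _ => ?_
      rw [map_smul, hD]
      exact Submodule.smul_mem _ _ (Submodule.subset_span ⟨c, rfl⟩)
    · rw [Submodule.span_le]
      rintro _ ⟨a, rfl⟩
      exact Submodule.subset_span ⟨E.vec a x, hD a⟩
  rw [hlift, Submodule.span_union, h1, h2, ← Submodule.span_union]

/-- The rank of the lifted map does not decrease with the order. -/
theorem liftRankAt_one_mono (hη : IsUnit η.det) (hx : x ∈ E.U) {p q : ℕ} (hpq : p ≤ q) :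
    E.liftRankAt p x 1 ≤ E.liftRankAt q x 1 := by
  rw [liftRankAt_one hη hx, liftRankAt_one hη hx]
  -- Forgetting the derivatives of order above `p` carries one spanning set onto the other.
  let π : CurvSpace n q →ₗ[ℝ] CurvSpace n p :=
    LinearMap.pi fun k => LinearMap.proj (R := ℝ) (φ := fun k : Fin (q + 1) => Tens n (4 + (k : ℕ)))
      (⟨k, by omega⟩ : Fin (q + 1))
  have : Submodule.span ℝ (Set.range (fun a => E.dirCurv p a x) ∪
        {w | ∃ B ∈ frameAlgebra η, w = curvDer B (E.curv p x)}) =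
      (Submodule.span ℝ (Set.range (fun a => E.dirCurv q a x) ∪
        {w | ∃ B ∈ frameAlgebra η, w = curvDer B (E.curv q x)})).map π := by
    rw [Submodule.map_span, Set.image_union]
    congr 2
    · ext w; constructor
      · rintro ⟨a, rfl⟩; exact ⟨_, ⟨a, rfl⟩, rfl⟩
      · rintro ⟨_, ⟨a, rfl⟩, rfl⟩; exact ⟨a, rfl⟩
    · ext w; constructor
      · rintro ⟨B, hB, rfl⟩; exact ⟨_, ⟨B, hB, rfl⟩, rfl⟩
      · rintro ⟨_, ⟨B, hB, rfl⟩, rfl⟩; exact ⟨B, hB, rfl⟩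
  rw [this]
  exact Submodule.finrank_map_le π _

end MovingFrame
end CurvHom
end

/-! ### The Lie algebra of null triads and its action on type N curvature. -/

noncomputable section
namespace CurvHom

open Tens

/-- The infinitesimal changes of null triad. -/
def nullAlg (x y w : ℝ) : Matrix (Fin 3) (Fin 3) ℝ := !![-y, 2 * x, 0; -w, 0, x; 0, -2 * w, y]

theorem etaNull_det : IsUnit etaNull.det := by
  rw [etaNull, Matrix.det_fin_three]; simp

theorem etaNull_inv : etaNull⁻¹ = !![0, 0, -1; 0, 2, 0; -1, 0, 0] := by
  apply Matrix.inv_eq_right_inv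
  ext i j
  fin_cases i <;> fin_cases j <;> simp [etaNull, Matrix.mul_apply, Fin.sum_univ_three]

theorem nullAlg_mem (x y w : ℝ) : nullAlg x y w ∈ frameAlgebra etaNull := by
  change nullAlg x y w * etaNull + etaNull * (nullAlg x y w)ᵀ = 0
  ext i j
  simp only [etaNull, nullAlg, Matrix.add_apply, Matrix.mul_apply, Fin.sum_univ_three,
    Matrix.transpose_apply, Matrix.of_apply]
  fin_cases i <;> fin_cases j <;> simp <;> ring

theorem exists_nullAlg {B : Matrix (Fin 3) (Fin 3) ℝ} (hB : B ∈ frameAlgebra etaNull) :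
    ∃ x y w, B = nullAlg x y w := by
  refine ⟨B 1 2, B 2 2, - B 1 0, ?_⟩
  have h : ∀ i j, (B * etaNull + etaNull * Bᵀ) i j = 0 := fun i j => congrFun (congrFun hB i) j
  simp only [etaNull, Matrix.add_apply, Matrix.mul_apply, Fin.sum_univ_three,
    Matrix.transpose_apply, Matrix.of_apply] at h
  have h00 := h 0 0
  have h01 := h 0 1
  have h02 := h 0 2
  have h11 := h 1 1
  have h12 := h 1 2
  have h22 := h 2 2
  simp at h00 h01 h02 h11 h12 h22
  ext i j
  fin_cases i <;> fin_cases j <;> simp [nullAlg] <;> linarith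

theorem nullAlg_add (x y w x' y' w' : ℝ) :
    nullAlg x y w + nullAlg x' y' w' = nullAlg (x + x') (y + y') (w + w') := by
  ext i j
  fin_cases i <;> fin_cases j <;> simp [nullAlg] <;> ring

theorem smul_nullAlg (c x y w : ℝ) : c • nullAlg x y w = nullAlg (c * x) (c * y) (c * w) := by
  ext i j
  fin_cases i <;> fin_cases j <;> simp [nullAlg] <;> ring

/-- The reversed order of the products matches the quadratic term in `curvMat_eq`. -/
theorem nullAlg_comm (x y w x' y' w' : ℝ) :
    nullAlg x' y' w' * nullAlg x y w - nullAlg x y w * nullAlg x' y' w' =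
      nullAlg (x' * y - x * y') (2 * (x' * w - x * w')) (w * y' - w' * y) := by
  ext i j
  fin_cases i <;> fin_cases j <;> simp [nullAlg] <;> ring

theorem nullAlg_inj {x y w x' y' w' : ℝ} (h : nullAlg x y w = nullAlg x' y' w') :
    x = x' ∧ y = y' ∧ w = w' := by
  have h1 := congrFun (congrFun h 1) 2
  have h2 := congrFun (congrFun h 2) 2
  have h3 := congrFun (congrFun h 1) 0
  simp [nullAlg] at h1 h2 h3
  exact ⟨h1, h2, h3⟩

/-- The curvature matrices of a curvature tensor of type N. -/
def modelMat (K P : ℝ) : Fin 3 → Fin 3 → Matrix (Fin 3) (Fin 3) ℝ :=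
  ![![0, nullAlg 0 0 (-(K / 2)), nullAlg 0 K 0],
    ![nullAlg 0 0 (K / 2), 0, nullAlg (-(K / 2)) 0 P],
    ![nullAlg 0 (-K) 0, nullAlg (K / 2) 0 (-P), 0]]

/-- The components of a curvature tensor of type N relative to an adapted null triad. -/
def modelRiem (K P : ℝ) : Tens 3 4 :=
  fun i => (modelMat K P (i 2) (i 3) * etaNull) (i 1) (i 0)

theorem Tens.der_four {n : ℕ} (A : Matrix (Fin n) (Fin n) ℝ) (T : Tens n 4) (a b c d : Fin n) :
    der A T ![a, b, c, d] = ∑ e, A a e * T ![e, b, c, d] + ∑ e, A b e * T ![a, e, c, d]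
      + ∑ e, A c e * T ![a, b, e, d] + ∑ e, A d e * T ![a, b, c, e] := by
  have h0 : ∀ e, Function.update ![a, b, c, d] 0 e = ![e, b, c, d] := fun e => by
    ext k; fin_cases k <;> rfl
  have h1 : ∀ e, Function.update ![a, b, c, d] 1 e = ![a, e, c, d] := fun e => by
    ext k; fin_cases k <;> rfl
  have h2 : ∀ e, Function.update ![a, b, c, d] 2 e = ![a, b, e, d] := fun e => by
    ext k; fin_cases k <;> rfl
  have h3 : ∀ e, Function.update ![a, b, c, d] 3 e = ![a, b, c, e] := fun e => by
    ext k; fin_cases k <;> rfl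
  simp only [der, Fin.sum_univ_four, h0, h1, h2, h3]
  rfl

theorem modelRiem_apply (K P : ℝ) (a b c d : Fin 3) :
    modelRiem K P ![a, b, c, d] = (modelMat K P c d * etaNull) b a := rfl

theorem nullAlg_mul_etaNull (x y w : ℝ) :
    nullAlg x y w * etaNull = !![0, x, y; -x, 0, w; -y, -w, 0] := by
  ext i j
  fin_cases i <;> fin_cases j <;>
    simp [etaNull, nullAlg] <;> ring

/-- Together with the component 0212 this bounds the isotropy: for P ≠ 0, a symmetry has y = 0 and x
= 0, so only null rotations about ℓ remain. -/
theorem der_modelRiem_1212 (K P x y w : ℝ) :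
    der (nullAlg x y w) (modelRiem K P) ![1, 2, 1, 2] = -(2 * P * y) := by
  simp [der_four, modelRiem_apply, Fin.sum_univ_three, modelMat, nullAlg_mul_etaNull]
  simp [nullAlg]
  ring

theorem der_modelRiem_0212 (K P x y w : ℝ) :
    der (nullAlg x y w) (modelRiem K P) ![0, 2, 1, 2] = -(2 * P * x) := by
  simp [der_four, modelRiem_apply, Fin.sum_univ_three, modelMat, nullAlg_mul_etaNull]
  simp [nullAlg]
  ring

theorem der_modelRiem_1202 (K P x y w : ℝ) :
    der (nullAlg x y w) (modelRiem K P) ![1, 2, 0, 2] = -(2 * P * x) := by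
  simp [der_four, modelRiem_apply, Fin.sum_univ_three, modelMat, nullAlg_mul_etaNull]
  simp [nullAlg]
  ring

theorem der_modelRiem_zero (K P x y w : ℝ) :
    der (nullAlg x y w) (modelRiem K P) ![1, 1, 1, 2] = 0 ∧
    der (nullAlg x y w) (modelRiem K P) ![1, 2, 1, 1] = 0 ∧
    der (nullAlg x y w) (modelRiem K P) ![0, 1, 1, 2] = 0 ∧
    der (nullAlg x y w) (modelRiem K P) ![0, 2, 0, 2] = 0 ∧
    der (nullAlg x y w) (modelRiem K P) ![0, 2, 1, 1] = 0 := by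
  refine ⟨?_, ?_, ?_, ?_, ?_⟩ <;>
  simp [der_four, modelRiem_apply, Fin.sum_univ_three, modelMat, nullAlg_mul_etaNull] <;>
  simp [nullAlg] <;>
  ring

/-- The converse half of the isotropy computation: every null rotation about ℓ does preserve the
model curvature. -/
theorem der_null_modelRiem (K P w : ℝ) : der (nullAlg 0 0 w) (modelRiem K P) = 0 := by
  ext i
  obtain ⟨a, b, c, d, rfl⟩ : ∃ a b c d, i = ![a, b, c, d] :=
    ⟨i 0, i 1, i 2, i 3, by ext k; fin_cases k <;> rfl⟩
  rw [der_four]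
  fin_cases a <;> fin_cases b <;> fin_cases c <;> fin_cases d <;>
  simp [modelRiem_apply, Fin.sum_univ_three, modelMat, nullAlg_mul_etaNull] <;>
  simp [nullAlg] <;>
  ring

end CurvHom
end

/-! ### Curvature in dimension three: from the Ricci tensor to the type N normal form. -/

noncomputable section
namespace CurvHom

open Tens

namespace MovingFrame

variable {M : Type*} [TopologicalSpace M] [ChartedSpace (EuclideanSpace ℝ (Fin 3)) M]
  [IsManifold (𝓡 3) ∞ M] {g : Metric M etaNull} {E E' : MovingFrame g} {x : M}

theorem connMat_eq_nullAlg (a : Fin 3) (x : M) :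
    E.connMat a x = nullAlg (E.connLow a 0 1 x) (E.connLow a 0 2 x) (E.connLow a 1 2 x) := by
  have h : ∀ b, E.connLow a b b x = 0 := fun b => by
    have := connLow_swap (E := E) (x := x) a b b
    linarith
  ext b c
  have h1 := connLow_swap (E := E) (x := x) a 1 0
  have h2 := connLow_swap (E := E) (x := x) a 2 0
  have h3 := connLow_swap (E := E) (x := x) a 2 1
  simp only [connMat, Matrix.of_apply, conn, etaNull_inv, Fin.sum_univ_three]
  fin_cases b <;> fin_cases c <;> simp [nullAlg, h, h1, h2, h3]

theorem dirMat_nullAlg {X Y W : M → ℝ} (a : Fin 3) (hx : x ∈ E.U) (hX : E.Smooth X)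
    (hW : E.Smooth W) :
    E.dirMat a (fun y => nullAlg (X y) (Y y) (W y)) x =
      nullAlg (E.dir a X x) (E.dir a Y x) (E.dir a W x) := by
  ext b c
  simp only [dirMat, Matrix.of_apply]
  fin_cases b <;> fin_cases c <;>
    simp [nullAlg, dir_neg, dir_const, dir_const_mul a 2 hx hX, dir_const_mul a 2 hx hW]

theorem curvMat_eq_nullAlg (hx : x ∈ E.U) (c d : Fin 3) :
    E.curvMat c d x = nullAlg
      (E.dir c (E.connLow d 0 1) x - E.dir d (E.connLow c 0 1) x
        + (E.connLow d 0 1 x * E.connLow c 0 2 x - E.connLow c 0 1 x * E.connLow d 0 2 x)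
        - ∑ f, E.bracket c d f x * E.connLow f 0 1 x)
      (E.dir c (E.connLow d 0 2) x - E.dir d (E.connLow c 0 2) x
        + 2 * (E.connLow d 0 1 x * E.connLow c 1 2 x - E.connLow c 0 1 x * E.connLow d 1 2 x)
        - ∑ f, E.bracket c d f x * E.connLow f 0 2 x)
      (E.dir c (E.connLow d 1 2) x - E.dir d (E.connLow c 1 2) x
        + (E.connLow c 1 2 x * E.connLow d 0 2 x - E.connLow d 1 2 x * E.connLow c 0 2 x)
        - ∑ f, E.bracket c d f x * E.connLow f 1 2 x) := by
  have h : ∀ a b, E.dirMat a (E.connMat b) x = nullAlg (E.dir a (E.connLow b 0 1) x)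
      (E.dir a (E.connLow b 0 2) x) (E.dir a (E.connLow b 1 2) x) := fun a b => by
    rw [← dirMat_nullAlg a hx (smooth_connLow _ _ _) (smooth_connLow _ _ _)]
    exact dirMat_congr a hx fun y _ => connMat_eq_nullAlg b y
  rw [curvMat_eq, h, h]
  simp only [connMat_eq_nullAlg, nullAlg_comm, smul_nullAlg, Fin.sum_univ_three, nullAlg_add]
  ext i j
  fin_cases i <;> fin_cases j <;> simp [nullAlg] <;> ring

theorem bracket_swap (a b c : Fin 3) : E.bracket a b c x = - E.bracket b a c x := by
  rw [← conn_sub, ← conn_sub]; ring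

theorem curvMat_swap (c d : Fin 3) : E.curvMat c d x = - E.curvMat d c x := by
  simp only [curvMat_eq, bracket_swap c d, neg_smul, Finset.sum_neg_distrib]
  abel

theorem ricci_eq (a b : Fin 3) : E.ricci a b x = ∑ c, E.curvMat c b x a c := rfl

/-- In three dimensions the curvature is determined by the Ricci tensor. -/
theorem curvMat_eq_modelMat (hx : x ∈ E.U) {Ψ : ℝ}
    (h : ∀ a b, E.traceFreeRicci a b x = (!![0, 0, 0; 0, 0, 0; 0, 0, Ψ] : Matrix _ _ ℝ) a b)
    (c d : Fin 3) : E.curvMat c d x = modelMat (E.scalar x / 6) (-(Ψ / 2)) c d := by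
  obtain ⟨x1, y1, w1, h1⟩ : ∃ x1 y1 w1, E.curvMat 0 1 x = nullAlg x1 y1 w1 :=
    ⟨_, _, _, curvMat_eq_nullAlg hx 0 1⟩
  obtain ⟨x2, y2, w2, h2⟩ : ∃ x1 y1 w1, E.curvMat 0 2 x = nullAlg x1 y1 w1 :=
    ⟨_, _, _, curvMat_eq_nullAlg hx 0 2⟩
  obtain ⟨x3, y3, w3, h3⟩ : ∃ x1 y1 w1, E.curvMat 1 2 x = nullAlg x1 y1 w1 :=
    ⟨_, _, _, curvMat_eq_nullAlg hx 1 2⟩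
  have h4 : E.curvMat 1 0 x = - nullAlg x1 y1 w1 := by rw [curvMat_swap, h1]
  have h5 : E.curvMat 2 0 x = - nullAlg x2 y2 w2 := by rw [curvMat_swap, h2]
  have h6 : E.curvMat 2 1 x = - nullAlg x3 y3 w3 := by rw [curvMat_swap, h3]
  have h7 : ∀ a, E.curvMat a a x = 0 := fun a => by
    have := curvMat_swap (E := E) (x := x) a a
    ext i j
    have h8 := congrFun (congrFun this i) j
    rw [Matrix.neg_apply] at h8
    exact self_eq_neg.1 h8
  simp only [traceFreeRicci, ricci_eq, Fin.sum_univ_three] at h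
  have e00 := h 0 0
  have e01 := h 0 1
  have e02 := h 0 2
  have e10 := h 1 0
  have e11 := h 1 1
  have e12 := h 1 2
  have e20 := h 2 0
  have e21 := h 2 1
  have e22 := h 2 2
  clear h
  have k : ∀ {A B : Matrix (Fin 3) (Fin 3) ℝ}, A = B → ∀ i j, A i j = B i j :=
    fun h i j => by rw [h]
  simp only [k h1, k h2, k h3, k h4, k h5, k h6, k (h7 _)] at e00 e01 e02 e10 e11 e12 e20 e21 e22
  generalize E.scalar x = s at *
  simp [nullAlg, etaNull] at e00 e01 e02 e10 e11 e12 e20 e21 e22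
  -- The nine Ricci components are linear equations in the nine entries of the three curvature
  -- matrices. The scalar curvature enters as a free parameter, and the unique solution is the model
  -- with K = R/6 and P = -Ψ₄/2.
  have a1 : x1 = 0 := by linarith
  have a2 : y1 = 0 := by linarith
  have a3 : w1 = -(s / 6 / 2) := by linarith
  have a4 : x2 = 0 := by linarith
  have a5 : y2 = s / 6 := by linarith
  have a6 : w2 = 0 := by linarith
  have a7 : x3 = -(s / 6 / 2) := by linarith
  have a8 : y3 = 0 := by linarith
  have a9 : w3 = -(Ψ / 2) := by linarith
  subst a1 a2 a3 a4 a5 a6 a7 a8 a9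
  have hneg : ∀ a b c, - nullAlg a b c = nullAlg (-a) (-b) (-c) := fun a b c => by
    rw [← neg_one_smul ℝ, smul_nullAlg]; simp
  fin_cases c <;> fin_cases d <;> simp [modelMat, h1, h2, h3, h4, h5, h6, h7, hneg]

theorem riem_eq_modelRiem_iff (hx : x ∈ E.U) {K P : ℝ} :
    E.riem x = modelRiem K P ↔ ∀ c d, E.curvMat c d x = modelMat K P c d := by
  constructor
  · intro h c d
    have h2 : E.curvMat c d x * etaNull = modelMat K P c d * etaNull := by
      ext b a
      have := congrFun h ![a, b, c, d]
      rw [riem_eq_curvMat hx] at this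
      exact this
    have h3 := congrArg (· * etaNull⁻¹) h2
    simpa only [Matrix.mul_assoc, Matrix.mul_nonsing_inv _ etaNull_det, Matrix.mul_one] using h3
  · intro h
    ext i
    rw [riem_eq_curvMat hx, h]
    rfl

end MovingFrame

end CurvHom
end

/-! ### Infinitesimal symmetries propagate to covariant derivatives; adapted frames. -/

noncomputable section
namespace CurvHom

open Tens

namespace MovingFrame

section General

variable {n : ℕ} {M : Type*} [TopologicalSpace M] [ChartedSpace (EuclideanSpace ℝ (Fin n)) M]
  [IsManifold (𝓡 n) ∞ M] {η : Matrix (Fin n) (Fin n) ℝ} {g : Metric M η} {E : MovingFrame g}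
  {x : M} {m : ℕ}

theorem dirTens_congr {T S : M → Tens n m} (a : Fin n) (hx : x ∈ E.U) (h : ∀ y ∈ E.U, T y = S y) :
    E.dirTens a T x = E.dirTens a S x :=
  funext fun i => dir_congr a hx fun y hy => by rw [h y hy]

theorem dirTens_const (a : Fin n) (T : Tens n m) : E.dirTens a (fun _ => T) x = 0 :=
  funext fun _ => dir_const a _

theorem dirTens_der {A : M → Matrix (Fin n) (Fin n) ℝ} {T : M → Tens n m} (a : Fin n)
    (hx : x ∈ E.U) (hA : E.SmoothMat A) (hT : ∀ i, E.Smooth fun y => T y i) :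
    E.dirTens a (fun y => der (A y) (T y)) x =
      der (E.dirMat a A x) (T x) + der (A x) (E.dirTens a T x) := by
  ext i
  simp only [dirTens, der, Pi.add_apply, ← Finset.sum_add_distrib]
  rw [dir_sum a _ hx fun k _ => smooth_sum fun b _ => (hA _ _).mul (hT _)]
  refine Finset.sum_congr rfl fun k _ => ?_
  rw [dir_sum a _ hx fun b _ => (hA _ _).mul (hT _)]
  refine Finset.sum_congr rfl fun b _ => ?_
  rw [dir_mul a hx (hA _ _) (hT _)]
  simp only [dirMat, Matrix.of_apply]
  ring

theorem smooth_der {A : M → Matrix (Fin n) (Fin n) ℝ} {T : M → Tens n m}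
    (hA : E.SmoothMat A) (hT : ∀ i, E.Smooth fun y => T y i) (i : Fin m → Fin n) :
    E.Smooth fun y => der (A y) (T y) i :=
  smooth_sum fun _ _ => smooth_sum fun _ _ => (hA _ _).mul (hT _)

theorem dirTens_sub {T S : M → Tens n m} (a : Fin n)
    (hx : x ∈ E.U) (hT : ∀ i, E.Smooth fun y => T y i) (hS : ∀ i, E.Smooth fun y => S y i) :
    E.dirTens a (fun y => T y - S y) x = E.dirTens a T x - E.dirTens a S x :=
  funext fun i => dir_sub a hx (hT i) (hS i)

theorem dirTens_comm (hη : IsUnit η.det) {T : M → Tens n m} (a b : Fin n)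
    (hx : x ∈ E.U) (hT : ∀ i, E.Smooth fun y => T y i) :
    E.dirTens a (E.dirTens b T) x - E.dirTens b (E.dirTens a T) x =
      ∑ c, E.bracket a b c x • E.dirTens c T x := by
  ext i
  simp only [Pi.sub_apply, Finset.sum_apply, Pi.smul_apply, smul_eq_mul, dirTens]
  exact dir_comm hη a b hx (hT i)

/-- If the frame field `E_o` is proportional to a Killing field, so that it acts on a tensor field
by an infinitesimal change of frame, then it acts in the same way on the covariant derivative. -/
theorem dirTens_covDeriv (hη : IsUnit η.det) (o : Fin n) {P : M → Matrix (Fin n) (Fin n) ℝ}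
    {c : Fin n → M → ℝ} (hP : E.SmoothMat P)
    (h1 : ∀ y ∈ E.U, ∀ a b, E.bracket o a b y = P y a b - c a y * (1 : Matrix _ _ ℝ) o b)
    (h2 : ∀ y ∈ E.U, ∀ a, E.dirMat a P y - E.dirMat o (E.connMat a) y
      + (P y * E.connMat a y - E.connMat a y * P y) + ∑ b, P y a b • E.connMat b y
      - c a y • P y = 0)
    {T : M → Tens n m} (hT : ∀ i, E.Smooth fun y => T y i)
    (h : ∀ y ∈ E.U, E.dirTens o T y = der (P y) (T y)) (hx : x ∈ E.U) :
    E.dirTens o (E.covDeriv T) x = der (P x) (E.covDeriv T x) := by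
  have hdT : ∀ a i, E.Smooth fun y => E.dirTens a T y i := fun a i => (hT i).dir a
  -- The hypotheses express that some φ E_o is Killing, with c_a = -E_a(log φ): `h1` says its flow
  -- turns the frame by φP, and `h2` that it preserves the connection. After division by φ, only P
  -- and c remain.
  have key : ∀ a, E.dirTens o (fun y => E.dirTens a T y - der (E.connMat a y) (T y)) x =
      der (P x) (E.dirTens a T x - der (E.connMat a x) (T x))
        + ∑ b, P x a b • (E.dirTens b T x - der (E.connMat b x) (T x)) := by
    intro a
    rw [dirTens_sub o hx (hdT a) (smooth_der (smoothMat_connMat a) hT),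
      dirTens_der o hx (smoothMat_connMat a) hT, h x hx]
    -- Commuting E_o past E_a brings in the hypothesis on E_o T. The bracket then supplies the
    -- rotation of the new derivative index, up to a c_a term that is absorbed by `h2`.
    have e1 := dirTens_comm (E := E) hη o a hx hT
    rw [dirTens_congr (T := E.dirTens o T) a hx h, dirTens_der a hx hP hT] at e1
    have e2 : ∑ b, E.bracket o a b x • E.dirTens b T x =
        ∑ b, P x a b • E.dirTens b T x - c a x • der (P x) (T x) := by
      simp only [h1 x hx, sub_smul, Finset.sum_sub_distrib]
      congr 1
      rw [Finset.sum_eq_single o]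
      · simp [h x hx]
      · intro b _ hb
        simp [Matrix.one_apply_ne (Ne.symm hb)]
      · simp
    rw [e2, sub_eq_iff_eq_add] at e1
    rw [show E.dirTens o (fun y => E.dirTens a T y) x = E.dirTens o (E.dirTens a T) x from rfl, e1]
    have e3 := congrArg (fun A => der A (T x)) (h2 x hx a)
    have e6 := der_der_sub (P x) (E.connMat a x) (T x)
    rw [sub_der] at e6
    simp only [sub_der, add_der, smul_der, sum_der, ← e6] at e3
    have e4 : der (0 : Matrix (Fin n) (Fin n) ℝ) (T x) = 0 := by ext i; simp [der]
    rw [e4] at e3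
    simp only [smul_sub, Finset.sum_sub_distrib, der_sub]
    rw [← sub_eq_zero, ← e3]
    abel
  ext i
  obtain ⟨j, a, rfl⟩ : ∃ (j : Fin m → Fin n) (a : Fin n), i = Fin.snoc j a :=
    ⟨Fin.init i, i (Fin.last m), (Fin.snoc_init_self i).symm⟩
  have e := congrFun (key a) j
  rw [der_succ]
  simp only [Fin.snoc_last, Fin.init_snoc, covDeriv_snoc]
  have e5 : E.dirTens o (E.covDeriv T) x (Fin.snoc j a) =
      E.dirTens o (fun y => E.dirTens a T y - der (E.connMat a y) (T y)) x j := by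
    simp only [dirTens, covDeriv_snoc]
  rw [e5, e]
  simp only [Pi.add_apply, Finset.sum_apply, Pi.smul_apply, smul_eq_mul]

end General

section NullTriad

variable {M : Type*} [TopologicalSpace M] [ChartedSpace (EuclideanSpace ℝ (Fin 3)) M]
  [IsManifold (𝓡 3) ∞ M] {g : Metric M etaNull} {E E' : MovingFrame g} {x : M} {K P : ℝ}

theorem der_null_1212 (T : Tens 3 4) : der (nullAlg 0 0 1) T ![1, 2, 1, 2] =
    -T ![0, 2, 1, 2] - 2 * T ![1, 1, 1, 2] - T ![1, 2, 0, 2] - 2 * T ![1, 2, 1, 1] := by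
  rw [der_four]
  simp [nullAlg, Fin.sum_univ_three]
  ring

theorem der_null_0212 (T : Tens 3 4) : der (nullAlg 0 0 1) T ![0, 2, 1, 2] =
    - 2 * T ![0, 1, 1, 2] - T ![0, 2, 0, 2] - 2 * T ![0, 2, 1, 1] := by
  rw [der_four]
  simp [nullAlg, Fin.sum_univ_three]
  ring

/-- The curvature is of type N with constant components, and the components of its covariant
derivative are invariant under the null rotations about the first frame vector. -/
structure IsAdapted (E : MovingFrame g) (K P : ℝ) : Prop where
  ne_zero : P ≠ 0
  riem_eq : ∀ x ∈ E.U, E.riem x = modelRiem K P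
  der_eq : ∀ x ∈ E.U, der (nullAlg 0 0 1) (E.riemDeriv 1 x) = 0

/-- The components of R are constant, so only the connection term of ∇R survives. -/
theorem IsAdapted.riemDeriv_one (h : E.IsAdapted K P) (hx : x ∈ E.U) (i : Fin 4 → Fin 3)
    (a : Fin 3) : E.riemDeriv 1 x (Fin.snoc i a) =
      - der (nullAlg (E.connLow a 0 1 x) (E.connLow a 0 2 x) (E.connLow a 1 2 x))
        (modelRiem K P) i := by
  change E.covDeriv E.riem x (Fin.snoc i a) = _
  rw [covDeriv_snoc, dirTens_congr a hx h.riem_eq, dirTens_const, h.riem_eq x hx, zero_sub,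
    connMat_eq_nullAlg]
  rfl

/-- Since R is constant, ∇R is linear in the connection, and the null rotation component of the
connection drops out because it preserves R. Invariance of ∇R then becomes linear equations in the
remaining components, read off from the slots 1212 and 0212. Geometrically, ℓ is affinely geodesic
and has no expansion along m. -/
theorem IsAdapted.conn (h : E.IsAdapted K P) (hx : x ∈ E.U) :
    E.connLow 0 0 1 x = 0 ∧ E.connLow 1 0 1 x = 0 ∧ E.connLow 0 0 2 x = 0 ∧
      E.connLow 2 0 1 x = - E.connLow 1 0 2 x := by
  have key : ∀ (i : Fin 4 → Fin 3) (a : Fin 3), der (nullAlg 0 0 1)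
      (der (nullAlg (E.connLow a 0 1 x) (E.connLow a 0 2 x) (E.connLow a 1 2 x))
        (modelRiem K P)) i + ∑ b, nullAlg 0 0 1 a b * der (nullAlg (E.connLow b 0 1 x)
          (E.connLow b 0 2 x) (E.connLow b 1 2 x)) (modelRiem K P) i = 0 := by
    -- The rotation acts on the four curvature slots and also on the derivative slot; the latter
    -- gives the sum over b.
    intro i a
    have h1 := congrFun (h.der_eq x hx) (Fin.snoc i a)
    rw [der_succ] at h1
    simp only [Fin.snoc_last, Fin.init_snoc, h.riemDeriv_one hx] at h1
    have h2 : der (nullAlg 0 0 1) (fun j : Fin 4 → Fin 3 => - der (nullAlg (E.connLow a 0 1 x)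
        (E.connLow a 0 2 x) (E.connLow a 1 2 x)) (modelRiem K P) j) =
        - der (nullAlg 0 0 1) (der (nullAlg (E.connLow a 0 1 x) (E.connLow a 0 2 x)
          (E.connLow a 1 2 x)) (modelRiem K P)) := by
      rw [← neg_one_smul ℝ (der (nullAlg 0 0 1) _), ← der_smul]
      congr 1
      ext j
      simp
    rw [h2] at h1
    simp only [mul_neg, Finset.sum_neg_distrib, Pi.neg_apply, Pi.zero_apply] at h1
    linarith
  have h1 : ∀ a, 4 * P * E.connLow a 0 1 x + ∑ b, nullAlg 0 0 1 a b *
      -(2 * P * E.connLow b 0 2 x) = 0 := by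
    intro a
    have := key ![1, 2, 1, 2] a
    obtain ⟨z1, z2, -, -, -⟩ := der_modelRiem_zero K P (E.connLow a 0 1 x) (E.connLow a 0 2 x)
      (E.connLow a 1 2 x)
    rw [der_null_1212, z1, z2, der_modelRiem_0212, der_modelRiem_1202] at this
    simp only [der_modelRiem_1212] at this
    linarith
  have h2 : 4 * P * E.connLow 1 0 1 x = 0 := by
    have := key ![0, 2, 1, 2] 2
    obtain ⟨-, -, z3, z4, z5⟩ := der_modelRiem_zero K P (E.connLow 2 0 1 x) (E.connLow 2 0 2 x)
      (E.connLow 2 1 2 x)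
    rw [der_null_0212, z3, z4, z5] at this
    simp only [der_modelRiem_0212] at this
    simp [nullAlg, Fin.sum_univ_three] at this
    rcases this with h | h <;> simp [h]
  have hP := h.ne_zero
  have a0 := h1 0
  have a1 := h1 1
  have a2 := h1 2
  simp [nullAlg, Fin.sum_univ_three, hP] at a0 a1 a2 h2
  have a3 : E.connLow 0 0 2 x = 0 := by simpa [h2, hP] using a1
  refine ⟨a0, h2, a3, ?_⟩
  have : 4 * P * (E.connLow 2 0 1 x + E.connLow 1 0 2 x) = 0 := by linarith
  simp [hP] at this
  linarith

end NullTriad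
end MovingFrame

end CurvHom
end

/-! ### Structure equations of an adapted frame, and the case B² + K/2 = 0. -/

noncomputable section
namespace CurvHom

open Tens

namespace MovingFrame

variable {M : Type*} [TopologicalSpace M] [ChartedSpace (EuclideanSpace ℝ (Fin 3)) M]
  [IsManifold (𝓡 3) ∞ M] {g : Metric M etaNull} {E E' : MovingFrame g} {x : M} {K P : ℝ}

theorem IsAdapted.dir_conn (h : E.IsAdapted K P) (hx : x ∈ E.U) (a : Fin 3) :
    E.dir a (E.connLow 0 0 1) x = 0 ∧ E.dir a (E.connLow 1 0 1) x = 0 ∧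
      E.dir a (E.connLow 0 0 2) x = 0 ∧
      E.dir a (E.connLow 2 0 1) x = - E.dir a (E.connLow 1 0 2) x := by
  refine ⟨?_, ?_, ?_, ?_⟩
  · rw [dir_congr a hx fun y hy => (h.conn hy).1, dir_const]
  · rw [dir_congr a hx fun y hy => (h.conn hy).2.1, dir_const]
  · rw [dir_congr a hx fun y hy => (h.conn hy).2.2.1, dir_const]
  · rw [dir_congr a hx fun y hy => (h.conn hy).2.2.2, dir_neg]

theorem IsAdapted.bracket (h : E.IsAdapted K P) (hx : x ∈ E.U) :
    (∀ c, E.bracket 0 1 c x = ![E.connLow 1 0 2 x - E.connLow 0 1 2 x, 0, 0] c) ∧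
    (∀ c, E.bracket 0 2 c x = ![E.connLow 2 0 2 x,
      2 * E.connLow 1 0 2 x - 2 * E.connLow 0 1 2 x, 0] c) ∧
    (∀ c, E.bracket 1 2 c x = ![E.connLow 2 1 2 x, -2 * E.connLow 1 1 2 x,
      2 * E.connLow 1 0 2 x] c) := by
  obtain ⟨h1, h2, h3, h4⟩ := h.conn hx
  have key : ∀ a b c, E.bracket a b c x = nullAlg (E.connLow a 0 1 x) (E.connLow a 0 2 x)
      (E.connLow a 1 2 x) b c - nullAlg (E.connLow b 0 1 x) (E.connLow b 0 2 x)
      (E.connLow b 1 2 x) a c := fun a b c => by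
    rw [← conn_sub, ← connMat_eq_nullAlg, ← connMat_eq_nullAlg]; rfl
  simp only [key, h1, h2, h3, h4]
  refine ⟨fun c => ?_, fun c => ?_, fun c => ?_⟩ <;> fin_cases c <;> simp [nullAlg] <;> ring

/-- The structure equations of an adapted frame. -/
theorem IsAdapted.structure_eq (h : E.IsAdapted K P) (hx : x ∈ E.U) :
    E.dir 0 (E.connLow 1 0 2) x = 0 ∧
    E.dir 1 (E.connLow 1 0 2) x = E.connLow 1 0 2 x ^ 2 + K / 2 ∧
    E.dir 0 (E.connLow 2 0 2) x = K + 2 * E.connLow 1 0 2 x ^ 2 ∧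
    E.dir 0 (E.connLow 1 1 2) x = E.dir 1 (E.connLow 0 1 2) x - E.connLow 0 1 2 x ^ 2 - K / 2 ∧
    E.dir 0 (E.connLow 2 1 2) x = E.dir 2 (E.connLow 0 1 2) x
      + 2 * (E.connLow 1 0 2 x - E.connLow 0 1 2 x) * E.connLow 1 1 2 x := by
  -- The curvature computed from the connection is equated with the type N model, entry by entry.
  have hc := fun c d => (curvMat_eq_nullAlg hx c d).symm.trans
    ((riem_eq_modelRiem_iff hx).1 (h.riem_eq x hx) c d)
  obtain ⟨h1, h2, h3, h4⟩ := h.conn hx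
  have hd := h.dir_conn hx
  obtain ⟨b1, b2, b3⟩ := h.bracket hx
  have c01 := hc 0 1
  have c02 := hc 0 2
  have c12 := hc 1 2
  simp only [b1, b2, b3, (hd _).1, (hd _).2.1, (hd _).2.2.1, (hd _).2.2.2, h1, h2, h3, h4,
    Fin.sum_univ_three, Matrix.cons_val] at c01 c02 c12
  replace c01 := nullAlg_inj (c01.trans (show _ = nullAlg 0 0 (-(K / 2)) from rfl))
  replace c02 := nullAlg_inj (c02.trans (show _ = nullAlg 0 K 0 from rfl))
  replace c12 := nullAlg_inj (c12.trans (show _ = nullAlg (-(K / 2)) 0 P from rfl))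
  obtain ⟨-, a1, a2⟩ := c01
  obtain ⟨-, a3, a4⟩ := c02
  obtain ⟨a5, -, -⟩ := c12
  refine ⟨?_, ?_, ?_, ?_, ?_⟩ <;> linarith

/-- If the first frame vector is proportional to a Killing field, then it acts on the curvature
by infinitesimal changes of frame. -/
theorem IsAdapted.dirTens_zero (h : E.IsAdapted K P)
    (hB : ∀ y ∈ E.U, E.connLow 1 0 2 y ^ 2 + K / 2 = 0) (k : ℕ) (hx : x ∈ E.U) :
    E.dirTens 0 (E.riemDeriv k) x =
      der (nullAlg 0 0 (E.connLow 0 1 2 x - E.connLow 1 0 2 x)) (E.riemDeriv k x) := by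
  induction k generalizing x with
  | zero =>
    change E.dirTens 0 E.riem x = der _ (E.riem x)
    rw [dirTens_congr 0 hx h.riem_eq, dirTens_const, h.riem_eq x hx, der_null_modelRiem]
  | succ k ih =>
    -- Since B² is constant, B dB = 0. This gives dB = 0 where B ≠ 0; if B vanishes at a point, then
    -- K = 0 and B vanishes identically.
    have hdB : ∀ a, ∀ y ∈ E.U, E.dir a (E.connLow 1 0 2) y = 0 := by
      intro a y hy
      by_cases h0 : E.connLow 1 0 2 y = 0
      · have hK : K = 0 := by have := hB y hy; rw [h0] at this; linarith
        rw [dir_congr (h := fun _ => 0) a hy fun z hz => ?_, dir_const]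
        have := hB z hz
        rw [hK] at this
        exact pow_eq_zero_iff (two_ne_zero) |>.1 (by linarith)
      · have e := dir_congr (E := E) a hy (f := fun z => E.connLow 1 0 2 z * E.connLow 1 0 2 z)
          (h := fun _ => - (K / 2)) fun z hz => by have := hB z hz; linarith
        rw [dir_const, dir_mul a hy (smooth_connLow _ _ _) (smooth_connLow _ _ _)] at e
        have : E.connLow 1 0 2 y * E.dir a (E.connLow 1 0 2) y = 0 := by linarith
        exact (mul_eq_zero.1 this).resolve_left h0
    have hs : E.SmoothMat fun y => nullAlg 0 0 (E.connLow 0 1 2 y - E.connLow 1 0 2 y) := by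
      have hw : E.Smooth fun y => E.connLow 0 1 2 y - E.connLow 1 0 2 y :=
        (smooth_connLow _ _ _).sub (smooth_connLow _ _ _)
      intro b c
      fin_cases b <;> fin_cases c <;>
        first | exact smooth_const _ | exact hw.neg | exact (smooth_const (-2)).mul hw
    -- The null rotation accounts for all of [E_0, E_a] except the E_0 component of [E_0, E_2],
    -- which is `connLow 2 0 2`. This forces the choice of `c`.
    refine dirTens_covDeriv etaNull_det 0 (c := fun a y => ![0, 0, - E.connLow 2 0 2 y] a) hs
      ?_ ?_ (smooth_riemDeriv k) (fun y hy => ih hy) hx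
    · intro y hy a b
      obtain ⟨b1, b2, -⟩ := h.bracket hy
      have b0 : E.bracket 0 0 b y = 0 := by
        have := bracket_swap (E := E) (x := y) 0 0 b
        linarith
      fin_cases a
      · fin_cases b <;> simp [nullAlg] <;> exact b0
      · rw [show E.bracket 0 ((fun i => i) ⟨1, by decide⟩) b y = _ from b1 b]
        fin_cases b <;> simp [nullAlg]
      · rw [show E.bracket 0 ((fun i => i) ⟨2, by decide⟩) b y = _ from b2 b]
        fin_cases b <;> simp [nullAlg, Matrix.one_apply]
        ring
    · intro y hy a
      obtain ⟨h1, h2, h3, h4⟩ := h.conn hy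
      obtain ⟨e1, e2, e3, e4, e5⟩ := h.structure_eq hy
      have hd := h.dir_conn hy
      have hBy := hB y hy
      rw [dirMat_nullAlg (X := fun _ => 0) (Y := fun _ => 0) a hy (smooth_const _)
        ((smooth_connLow _ _ _).sub (smooth_connLow _ _ _)), dir_const,
        dir_sub a hy (smooth_connLow _ _ _) (smooth_connLow _ _ _), hdB a y hy,
        dirMat_congr 0 hy fun z _ => connMat_eq_nullAlg a z,
        dirMat_nullAlg 0 hy (smooth_connLow _ _ _) (smooth_connLow _ _ _)]
      simp only [connMat_eq_nullAlg, nullAlg_comm, smul_nullAlg, Fin.sum_univ_three, nullAlg_add]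
      ext i j
      fin_cases a <;> fin_cases i <;> fin_cases j <;>
        simp [nullAlg, h1, h2, h3, h4, hd, e1, e3, e4, e5] <;> linarith [hdB 0 y hy]

end MovingFrame
end CurvHom
end

/-! ### Bounds on the lifted rank. -/

noncomputable section
namespace CurvHom

open Tens

theorem curvDer_nullAlg {p : ℕ} (x y w : ℝ) (T : CurvSpace 3 p) :
    curvDer (nullAlg x y w) T = x • curvDer (nullAlg 1 0 0) T + y • curvDer (nullAlg 0 1 0) T
      + w • curvDer (nullAlg 0 0 1) T := by
  funext k
  change der _ _ = x • der _ _ + y • der _ _ + w • der _ _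
  rw [← smul_der, ← smul_der, ← smul_der, ← add_der, ← add_der]
  simp [smul_nullAlg, nullAlg_add]

namespace MovingFrame

variable {M : Type*} [TopologicalSpace M] [ChartedSpace (EuclideanSpace ℝ (Fin 3)) M]
  [IsManifold (𝓡 3) ∞ M] {g : Metric M etaNull} {E E' : MovingFrame g} {x : M} {K P : ℝ} {p : ℕ}

/-- Three horizontal and three vertical directions: the dimension of the bundle of null triads. -/
theorem liftRankAt_one_le_six (hx : x ∈ E.U) : E.liftRankAt p x 1 ≤ 6 := by
  rw [liftRankAt_one etaNull_det hx]
  let v : Fin 6 → CurvSpace 3 p := ![E.dirCurv p 0 x, E.dirCurv p 1 x, E.dirCurv p 2 x,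
    curvDer (nullAlg 1 0 0) (E.curv p x), curvDer (nullAlg 0 1 0) (E.curv p x),
    curvDer (nullAlg 0 0 1) (E.curv p x)]
  have hv : ∀ i, v i ∈ Submodule.span ℝ (Set.range v) := fun i => Submodule.subset_span ⟨i, rfl⟩
  refine (Submodule.finrank_mono (Submodule.span_le.2 ?_)).trans
    ((finrank_range_le_card v).trans (by simp))
  rintro w (⟨a, rfl⟩ | ⟨B, hB, rfl⟩)
  · fin_cases a
    exacts [hv 0, hv 1, hv 2]
  · obtain ⟨x, y, w, rfl⟩ := exists_nullAlg hB
    rw [curvDer_nullAlg]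
    exact add_mem (add_mem (Submodule.smul_mem _ _ (hv 3)) (Submodule.smul_mem _ _ (hv 4)))
      (Submodule.smul_mem _ _ (hv 5))

/-- By `dirTens_zero` the derivative along ℓ is already vertical, so one of the six directions is
redundant. -/
theorem IsAdapted.liftRankAt_one_le_five (h : E.IsAdapted K P)
    (hB : ∀ y ∈ E.U, E.connLow 1 0 2 y ^ 2 + K / 2 = 0) (hx : x ∈ E.U) :
    E.liftRankAt p x 1 ≤ 5 := by
  rw [liftRankAt_one etaNull_det hx]
  let v : Fin 5 → CurvSpace 3 p := ![E.dirCurv p 1 x, E.dirCurv p 2 x,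
    curvDer (nullAlg 1 0 0) (E.curv p x), curvDer (nullAlg 0 1 0) (E.curv p x),
    curvDer (nullAlg 0 0 1) (E.curv p x)]
  have hv : ∀ i, v i ∈ Submodule.span ℝ (Set.range v) := fun i => Submodule.subset_span ⟨i, rfl⟩
  have hd : ∀ x y w, curvDer (nullAlg x y w) (E.curv p ‹_›) ∈ Submodule.span ℝ (Set.range v) := by
    intro x y w
    rw [curvDer_nullAlg]
    exact add_mem (add_mem (Submodule.smul_mem _ _ (hv 2)) (Submodule.smul_mem _ _ (hv 3)))
      (Submodule.smul_mem _ _ (hv 4))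
  refine (Submodule.finrank_mono (Submodule.span_le.2 ?_)).trans
    ((finrank_range_le_card v).trans (by simp))
  rintro w (⟨a, rfl⟩ | ⟨B, hB, rfl⟩)
  · fin_cases a
    · have : E.dirCurv p 0 x = curvDer
          (nullAlg 0 0 (E.connLow 0 1 2 x - E.connLow 1 0 2 x)) (E.curv p x) :=
        funext fun k => h.dirTens_zero hB k hx
      change E.dirCurv p 0 x ∈ Submodule.span ℝ (Set.range v)
      rw [this]
      exact hd _ _ _
    · exact hv 0
    · exact hv 1
  · obtain ⟨x, y, w, rfl⟩ := exists_nullAlg hB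
    exact hd _ _ _

/-- The two directions complementary to the isotropy of R are detected separately by the components
0212 and 1212. -/
theorem IsAdapted.two_le_liftRankAt_one (h : E.IsAdapted K P) (hx : x ∈ E.U) :
    2 ≤ E.liftRankAt 0 x 1 := by
  rw [liftRankAt_one etaNull_det hx]
  let v : Fin 2 → CurvSpace 3 0 := ![curvDer (nullAlg 1 0 0) (E.curv 0 x),
    curvDer (nullAlg 0 1 0) (E.curv 0 x)]
  have hc : ∀ x' y w (i : Fin 4 → Fin 3), curvDer (nullAlg x' y w) (E.curv 0 x) 0 i =
      der (nullAlg x' y w) (modelRiem K P) i := fun x' y w i => by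
    rw [← h.riem_eq x hx]; rfl
  have hv : LinearIndependent ℝ v := by
    rw [Fintype.linearIndependent_iff]
    intro c hc0
    have e : ∀ i : Fin 4 → Fin 3, c 0 * curvDer (nullAlg 1 0 0) (E.curv 0 x) 0 i +
        c 1 * curvDer (nullAlg 0 1 0) (E.curv 0 x) 0 i = 0 := fun i => by
      have := congrFun (congrFun hc0 0) i
      simpa [v, Fin.sum_univ_two] using this
    have e1 := e ![0, 2, 1, 2]
    have e2 := e ![1, 2, 1, 2]
    simp only [hc, der_modelRiem_0212, der_modelRiem_1212] at e1 e2
    simp [h.ne_zero] at e1 e2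
    intro i
    fin_cases i
    exacts [e1, e2]
  refine (Fintype.card_fin 2).symm.le.trans ((finrank_span_eq_card hv).symm.le.trans
    (Submodule.finrank_mono (Submodule.span_mono ?_)))
  rintro _ ⟨i, rfl⟩
  fin_cases i
  · exact Or.inr ⟨_, nullAlg_mem _ _ _, rfl⟩
  · exact Or.inr ⟨_, nullAlg_mem _ _ _, rfl⟩

/-- R has zero horizontal derivative, so its components isolate the two vertical coefficients. The
components 1212;1 and 1212;2 of ∇R then give a triangular system in the derivatives along ℓ and m,
with diagonal entries proportional to B² + K/2. -/
theorem IsAdapted.four_le_liftRankAt_one (h : E.IsAdapted K P) (hx : x ∈ E.U)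
    (hB : E.connLow 1 0 2 x ^ 2 + K / 2 ≠ 0) : 4 ≤ E.liftRankAt 1 x 1 := by
  rw [liftRankAt_one etaNull_det hx]
  let v : Fin 4 → CurvSpace 3 1 := ![curvDer (nullAlg 1 0 0) (E.curv 1 x),
    curvDer (nullAlg 0 1 0) (E.curv 1 x), E.dirCurv 1 0 x, E.dirCurv 1 1 x]
  have hc : ∀ x' y w (i : Fin 4 → Fin 3), curvDer (nullAlg x' y w) (E.curv 1 x) 0 i =
      der (nullAlg x' y w) (modelRiem K P) i := fun x' y w i => by
    rw [← h.riem_eq x hx]; rfl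
  have hd0 : ∀ a (i : Fin 4 → Fin 3), E.dirCurv 1 a x 0 i = 0 := fun a i => by
    have : E.dirTens a E.riem x = 0 := by
      rw [dirTens_congr a hx h.riem_eq, dirTens_const]
    exact congrFun this i
  have hd1 : ∀ a b, E.dirCurv 1 a x 1 (Fin.snoc (![1, 2, 1, 2] : Fin 4 → Fin 3) b) =
      2 * P * E.dir a (E.connLow b 0 2) x := fun a b => by
    have : E.dirTens a (E.riemDeriv 1) x (Fin.snoc (![1, 2, 1, 2] : Fin 4 → Fin 3) b) =
        2 * P * E.dir a (E.connLow b 0 2) x := by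
      rw [← dir_const_mul a _ hx (smooth_connLow _ _ _)]
      refine dir_congr a hx fun y hy => ?_
      rw [h.riemDeriv_one hy, der_modelRiem_1212, neg_neg]
    exact this
  obtain ⟨s1, s2, s3, -⟩ := h.structure_eq hx
  have hv : LinearIndependent ℝ v := by
    rw [Fintype.linearIndependent_iff]
    intro c hc0
    have e : ∀ (k : Fin 2) (i : Fin (4 + (k : ℕ)) → Fin 3),
        c 0 * curvDer (nullAlg 1 0 0) (E.curv 1 x) k i +
        c 1 * curvDer (nullAlg 0 1 0) (E.curv 1 x) k i + c 2 * E.dirCurv 1 0 x k i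
        + c 3 * E.dirCurv 1 1 x k i = 0 := fun k i => by
      have := congrFun (congrFun hc0 k) i
      simpa [v, Fin.sum_univ_four] using this
    have e1 := e 0 (![0, 2, 1, 2] : Fin 4 → Fin 3)
    have e2 := e 0 (![1, 2, 1, 2] : Fin 4 → Fin 3)
    simp only [hc, hd0, der_modelRiem_0212, der_modelRiem_1212] at e1 e2
    simp [h.ne_zero] at e1 e2
    -- The slot 1212;1 is constant along ℓ, since ℓ(B) = 0, so it eliminates the coefficient of the
    -- m-derivative first.
    have e3 := e 1 (Fin.snoc (![1, 2, 1, 2] : Fin 4 → Fin 3) 1)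
    have e4 := e 1 (Fin.snoc (![1, 2, 1, 2] : Fin 4 → Fin 3) 2)
    rw [hd1, hd1, e1, e2, s1, s2] at e3
    rw [hd1, hd1, e1, e2, s3] at e4
    have hB2 : K + 2 * E.connLow 1 0 2 x ^ 2 ≠ 0 := fun h0 => hB (by linarith)
    simp [h.ne_zero, hB] at e3
    simp [h.ne_zero, hB2, e3] at e4
    intro i
    fin_cases i
    exacts [e1, e2, e4, e3]
  refine (Fintype.card_fin 4).symm.le.trans ((finrank_span_eq_card hv).symm.le.trans
    (Submodule.finrank_mono (Submodule.span_mono ?_)))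
  rintro _ ⟨i, rfl⟩
  fin_cases i
  · exact Or.inr ⟨_, nullAlg_mem _ _ _, rfl⟩
  · exact Or.inr ⟨_, nullAlg_mem _ _ _, rfl⟩
  · exact Or.inl ⟨0, rfl⟩
  · exact Or.inl ⟨1, rfl⟩

end MovingFrame
end CurvHom
end

/-! ### Locally constant maps, constant changes of frame, infinitesimal symmetries. -/

noncomputable section
namespace CurvHom

open Tens

section LocallyConstant

variable {n : ℕ} {M : Type*} [TopologicalSpace M] [ChartedSpace (EuclideanSpace ℝ (Fin n)) M]
  [IsManifold (𝓡 n) ∞ M] {W : Type*} [NormedAddCommGroup W] [NormedSpace ℝ W]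

/-- Read in a chart on a ball, the map has zero derivative on a connected open set. -/
theorem exists_isOpen_eq_of_mfderiv_eq_zero {f : M → W} {U : Set M} (hU : IsOpen U)
    (hf : ∀ y ∈ U, MDifferentiableAt (𝓡 n) 𝓘(ℝ, W) f y)
    (h0 : ∀ y ∈ U, mfderiv (𝓡 n) 𝓘(ℝ, W) f y = 0) {x : M} (hx : x ∈ U) :
    ∃ V : Set M, IsOpen V ∧ x ∈ V ∧ ∀ y ∈ V, f y = f x := by
  set φ := extChartAt (𝓡 n) x with hφ
  have hO : IsOpen (φ.target ∩ φ.symm ⁻¹' U) :=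
    (continuousOn_extChartAt_symm x).isOpen_inter_preimage (isOpen_extChartAt_target x) hU
  have hxO : φ x ∈ φ.target ∩ φ.symm ⁻¹' U :=
    ⟨mem_extChartAt_target x, by rwa [Set.mem_preimage, extChartAt_to_inv]⟩
  obtain ⟨ε, hε, hB⟩ := Metric.isOpen_iff.1 hO _ hxO
  have hd : ∀ z ∈ Metric.ball (φ x) ε, HasFDerivAt (f ∘ φ.symm)
      (0 : EuclideanSpace ℝ (Fin n) →L[ℝ] W) z := by
    intro z hz
    obtain ⟨hz1, hz2⟩ := hB hz
    have h1 : MDifferentiableAt 𝓘(ℝ, EuclideanSpace ℝ (Fin n)) (𝓡 n) φ.symm z := by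
      have := mdifferentiableWithinAt_extChartAt_symm (I := 𝓡 n) hz1
      rwa [ModelWithCorners.range_eq_univ, mdifferentiableWithinAt_univ] at this
    have h2 := (hf _ hz2).hasMFDerivAt.comp z h1.hasMFDerivAt
    rw [h0 _ hz2, hasMFDerivAt_iff_hasFDerivAt, ContinuousLinearMap.zero_comp] at h2
    exact h2
  refine ⟨φ.source ∩ φ ⁻¹' Metric.ball (φ x) ε,
    (continuousOn_extChartAt x).isOpen_inter_preimage (isOpen_extChartAt_source x)
      Metric.isOpen_ball, ⟨mem_extChartAt_source x, Metric.mem_ball_self hε⟩, ?_⟩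
  rintro y ⟨hy1, hy2⟩
  have := Metric.isOpen_ball.is_const_of_fderiv_eq_zero (𝕜 := ℝ)
    (convex_ball (φ x) ε).isPreconnected
    (fun z hz => (hd z hz).differentiableAt.differentiableWithinAt)
    (fun z hz => (hd z hz).fderiv) hy2 (Metric.mem_ball_self hε)
  rwa [Function.comp_apply, Function.comp_apply, φ.left_inv hy1, extChartAt_to_inv] at this

end LocallyConstant

section Frames

variable {n : ℕ} {M : Type*} [TopologicalSpace M] [ChartedSpace (EuclideanSpace ℝ (Fin n)) M]
  [IsManifold (𝓡 n) ∞ M] {η : Matrix (Fin n) (Fin n) ℝ} {g : Metric M η}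
  {x : M} {k : ℕ}

namespace MovingFrame

variable {E E' : MovingFrame g}

/-- The frame obtained by a constant orthogonal change of frame. -/
def rotate (E : MovingFrame g) (Z : Matrix (Fin n) (Fin n) ℝ) (hZ : Z * η * Zᵀ = η) :
    MovingFrame g where
  U := E.U
  isOpen := E.isOpen
  vec a x := ∑ b, Z a b • E.vec b x
  smooth a := ContMDiffOn.sum_section fun b _ => (E.smooth b).const_smul_section
  orth a b x hx := by
    rw [← congrFun (congrFun hZ a) b]
    simp only [Matrix.mul_apply, Matrix.transpose_apply, map_sum, map_smul, sum_apply,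
      smul_apply, smul_eq_mul, E.orth _ _ x hx, Finset.sum_mul, Finset.mul_sum]
    refine Finset.sum_congr rfl fun c _ => Finset.sum_congr rfl fun d _ => ?_
    ring

/-- Frame vectors are independent, so the transition matrix at a point is unique and any known one
may be used. -/
theorem riemDeriv_eq_act (hη : IsUnit η.det) (hx : x ∈ E.U) (hx' : x ∈ E'.U)
    {Z : Matrix (Fin n) (Fin n) ℝ} (h : ∀ a, E'.vec a x = ∑ b, Z a b • E.vec b x) (k : ℕ) :
    E'.riemDeriv k x = act Z (E.riemDeriv k x) := by
  obtain ⟨Y, -, hY, hk⟩ := exists_riemDeriv_eq_act E E' hη hx hx'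
  suffices Y = Z by rw [← this, hk]
  ext a b
  have h1 : ∑ b, (Y a b - Z a b) • E.vec b x = 0 := by
    simp only [sub_smul, Finset.sum_sub_distrib]
    rw [← hY, ← h, sub_self]
  exact sub_eq_zero.1
    (Fintype.linearIndependent_iff.1 (E.linearIndependent_vec hη hx) _ h1 b)

end MovingFrame

/-- A group of positive dimension that preserves `η` contains a one-parameter subgroup. -/
theorem exists_orthAlgebra_of_groupDim_pos {G : Subgroup (GL (Fin n) ℝ)} (hG : G ≤ orthGroup η)
    (h : 0 < groupDim G) : ∃ A ∈ orthAlgebra η, A ≠ 0 ∧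
      ∀ t : ℝ, ∃ X ∈ G, (X : Matrix (Fin n) (Fin n) ℝ) = NormedSpace.exp (t • A) := by
  by_contra! hc
  refine h.ne' ?_
  rw [groupDim, Submodule.span_eq_bot.2, finrank_bot]
  intro A hA
  by_contra hA0
  -- Differentiating exp(tA)ᵀ η exp(tA) = η at t = 0.
  have hmem : A ∈ orthAlgebra η := by
    have hexp : ∀ t : ℝ, (NormedSpace.exp (t • A))ᵀ * η * NormedSpace.exp (t • A) = η := by
      intro t
      obtain ⟨X, hX, e⟩ := hA t
      rw [← e]
      exact hG hX
    change Aᵀ * η + η * A = 0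
    ext i j
    have h1 : HasDerivAt (fun t : ℝ => ∑ b, (∑ a, NormedSpace.exp (t • A) a i * η a b) *
        NormedSpace.exp (t • A) b j) (∑ b, ((∑ a, A a i * η a b) * (1 : Matrix (Fin n) (Fin n) ℝ) b j
          + (∑ a, (1 : Matrix (Fin n) (Fin n) ℝ) a i * η a b) * A b j)) 0 := by
      refine HasDerivAt.fun_sum fun b _ => ?_
      have h2 : HasDerivAt (fun t : ℝ => ∑ a, NormedSpace.exp (t • A) a i * η a b)
          (∑ a, A a i * η a b) 0 :=
        HasDerivAt.fun_sum fun a _ => (hasDerivAt_exp_entry A a i).mul_const _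
      refine (h2.mul (hasDerivAt_exp_entry A b j)).congr_deriv ?_
      simp only [zero_smul, NormedSpace.exp_zero]
    have h3 : (fun t : ℝ => ∑ b, (∑ a, NormedSpace.exp (t • A) a i * η a b) *
        NormedSpace.exp (t • A) b j) = fun _ => η i j := by
      funext t
      rw [← congrFun (congrFun (hexp t) i) j]
      simp [Matrix.mul_apply]
    rw [h3] at h1
    have h4 := h1.unique (hasDerivAt_const (0 : ℝ) (η i j))
    simpa [Matrix.mul_apply, Matrix.one_apply, Finset.sum_add_distrib] using h4
  obtain ⟨t, ht⟩ := hc A hmem hA0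
  obtain ⟨X, hX, e⟩ := hA t
  exact ht X hX e

/-- If the normalized curvature has a positive-dimensional symmetry group, then in each frame the
curvature has an infinitesimal symmetry. -/
theorem IsNormalizing.exists_symmetry {S : Set (CurvSpace n k)} {G : Subgroup (GL (Fin n) ℝ)}
    (h : IsNormalizing g k S G) (hG : 0 < groupDim G) (hη : IsUnit η.det) (E : MovingFrame g)
    (hx : x ∈ E.U) : ∃ B ∈ frameAlgebra η, B ≠ 0 ∧ ∀ j ≤ k, der B (E.riemDeriv j x) = 0 := by
  obtain ⟨A, hA, hA0, hexp⟩ := exists_orthAlgebra_of_groupDim_pos h.le hG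
  obtain ⟨F, hxF, hF⟩ := h.cover x
  obtain ⟨Z, hZ, -, hk⟩ := MovingFrame.exists_riemDeriv_eq_act F E hη hxF hx
  -- The one-parameter subgroup fixes the cross-section pointwise, so its derivative annihilates the
  -- normalized curvature.
  have hB : curvDer (-Aᵀ) (F.curv k x) = 0 := by
    refine (hasDerivAt_curvAct_exp A (F.curv k x)).unique ?_
    convert hasDerivAt_const (0 : ℝ) (F.curv k x) using 1
    funext t
    obtain ⟨X, hX, e⟩ := hexp t
    rw [← e, h.fixes X hX _ (hF x hxF)]
  obtain ⟨Y, hY⟩ : ∃ Y, Z * Y = 1 := ⟨η * Zᵀ * η⁻¹, by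
    rw [← Matrix.mul_assoc, ← Matrix.mul_assoc, hZ, Matrix.mul_nonsing_inv _ hη]⟩
  have hY' := mul_eq_one_comm.1 hY
  have hBmem : -Aᵀ * η + η * (-Aᵀ)ᵀ = 0 := neg_transpose_mem_frameAlgebra.2 hA
  have hB0 : -Aᵀ ≠ 0 := by simpa using hA0
  generalize -Aᵀ = B at hB hBmem hB0
  -- The symmetry, found in a normalized frame, is carried to the frame E by conjugation with the
  -- transition matrix.
  refine ⟨Z * B * Y, ?_, ?_, fun j hj => ?_⟩
  · have e1 : (Z * B * Y) * η = Z * (B * η) * Zᵀ := by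
      conv_lhs => rw [← hZ]
      rw [show Z * B * Y * (Z * η * Zᵀ) = Z * B * (Y * Z) * η * Zᵀ by
        simp only [Matrix.mul_assoc], hY']
      simp only [Matrix.mul_assoc, Matrix.one_mul]
    have e2 : η * (Z * B * Y)ᵀ = Z * (η * Bᵀ) * Zᵀ := by
      conv_lhs => rw [← hZ]
      rw [Matrix.transpose_mul, Matrix.transpose_mul,
        show Z * η * Zᵀ * (Yᵀ * (Bᵀ * Zᵀ)) = Z * η * (Zᵀ * Yᵀ) * Bᵀ * Zᵀ by
        simp only [Matrix.mul_assoc], ← Matrix.transpose_mul, hY']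
      simp only [Matrix.mul_assoc, Matrix.transpose_one, Matrix.one_mul]
    change _ + _ = _
    rw [e1, e2, ← Matrix.add_mul, ← Matrix.mul_add, hBmem, Matrix.mul_zero, Matrix.zero_mul]
  · intro h0
    refine hB0 ?_
    calc B = (Y * Z) * B * (Y * Z) := by rw [hY']; simp
      _ = Y * (Z * B * Y) * Z := by simp only [Matrix.mul_assoc]
      _ = 0 := by rw [h0]; simp
  · have := congrFun hB ⟨j, Nat.lt_succ_of_le hj⟩
    change der B (F.riemDeriv j x) = 0 at this
    rw [hk, der_act, Matrix.mul_assoc, hY', Matrix.mul_one, ← act_der, this]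
    ext i
    simp [act]

end Frames

end CurvHom
end

/-! ### Existence of adapted frames. -/

noncomputable section
namespace CurvHom

open Tens MovingFrame

section Rank

variable {n : ℕ} {M : Type*} [TopologicalSpace M] [ChartedSpace (EuclideanSpace ℝ (Fin n)) M]
  [IsManifold (𝓡 n) ∞ M] {η : Matrix (Fin n) (Fin n) ℝ} {g : Metric M η} {x : M}

theorem eq_zero_of_finrank_range_eq_zero {V W : Type*} [AddCommGroup V] [Module ℝ V]
    [TopologicalSpace V] [AddCommGroup W] [Module ℝ W] [TopologicalSpace W] [Module.Finite ℝ V]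
    (L : V →L[ℝ] W) (h : Module.finrank ℝ (LinearMap.range L.toLinearMap) = 0) : L = 0 := by
  have h1 := LinearMap.range_eq_bot.1 (Submodule.finrank_eq_zero.1 h)
  ext v
  exact LinearMap.congr_fun h1 v

/-- Since t_0 = 0, the normalized curvature has zero differential, hence is constant after shrinking
the domain. -/
theorem IsCurvatureHomogeneous.exists_frame (h : IsCurvatureHomogeneous g 0) (x : M) :
    ∃ E : MovingFrame g, x ∈ E.U ∧ ∀ y ∈ E.U, E.riem y = E.riem x := by
  obtain ⟨-, S, G, hS, hE⟩ := h
  obtain ⟨E, hx, hES⟩ := hS.cover x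
  have h0 : ∀ y ∈ E.U, mfderiv (𝓡 n) 𝓘(ℝ, CurvSpace n 0) (E.curv 0) y = 0 := by
    intro y hy
    exact eq_zero_of_finrank_range_eq_zero (V := EuclideanSpace ℝ (Fin n))
      (W := CurvSpace n 0) _ (hE E hES y hy)
  obtain ⟨V, hV, hxV, hc⟩ := exists_isOpen_eq_of_mfderiv_eq_zero E.isOpen
    (fun y hy => mdifferentiableAt_curv hy) h0 hx
  refine ⟨E.restrict hV, ⟨hx, hxV⟩, fun y hy => ?_⟩
  have h2 := riemDeriv_restrict E hV 0
  change (E.restrict hV).riemDeriv 0 y = (E.restrict hV).riemDeriv 0 x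
  rw [h2]
  exact congrFun (hc y hy.2) 0

theorem liftRankAt_eq_of_hasRank {p r : ℕ} (h : HasRank g p r) {E : MovingFrame g}
    (hx : x ∈ E.U) : E.liftRankAt p x 1 = r :=
  h E x hx 1 (one_mem _)

end Rank

variable {M : Type*} [TopologicalSpace M] [ChartedSpace (EuclideanSpace ℝ (Fin 3)) M]
  [IsManifold (𝓡 3) ∞ M] {g : Metric M etaNull}

/-- A constant rotation suffices: a frame with constant curvature components is turned to agree at
`x` with a type N triad, and the model form then holds on its whole domain. Positive dimension of
G_k supplies a symmetry of R and, as k ≥ 1, of ∇R; fixing the model, it must be a null rotation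
about ℓ. -/
theorem exists_isAdapted (hCH : IsCurvatureHomogeneous g 0) {x : M} (hN : IsTypeNAt g x) {k : ℕ}
    (hk : 1 ≤ k) {S : Set (CurvSpace 3 k)} {G : Subgroup (GL (Fin 3) ℝ)}
    (hS : IsNormalizing g k S G) (hG : 0 < groupDim G) :
    ∃ (E : MovingFrame g) (K P : ℝ), x ∈ E.U ∧ E.IsAdapted K P := by
  obtain ⟨F, hxF, hF⟩ := hCH.exists_frame x
  obtain ⟨N, hxN, Ψ, hΨ, hNΨ⟩ := hN
  obtain ⟨Z, hZ, -, hZk⟩ := exists_riemDeriv_eq_act F N etaNull_det hxF hxN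
  set K := N.scalar x / 6
  set P := -(Ψ / 2) with hP
  have hP0 : P ≠ 0 := by rcases hΨ with rfl | rfl <;> norm_num [hP]
  have hriem : ∀ y ∈ F.U, (F.rotate Z hZ).riem y = modelRiem K P := by
    intro y hy
    have h1 : (F.rotate Z hZ).riem y = act Z (F.riem y) :=
      riemDeriv_eq_act (E := F) (E' := F.rotate Z hZ) etaNull_det hy hy (fun _ => rfl) 0
    have h2 : N.riem x = act Z (F.riem x) := hZk 0
    rw [h1, hF y hy, ← h2]
    exact (riem_eq_modelRiem_iff hxN).2 (curvMat_eq_modelMat hxN hNΨ)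
  refine ⟨F.rotate Z hZ, K, P, hxF, hP0, hriem, fun y hy => ?_⟩
  obtain ⟨B, hB, hB0, hBk⟩ := hS.exists_symmetry hG etaNull_det (F.rotate Z hZ) hy
  obtain ⟨a, b, w, rfl⟩ := exists_nullAlg hB
  have h0 : der (nullAlg a b w) (modelRiem K P) = 0 := by
    rw [← hriem y hy]
    exact hBk 0 (Nat.zero_le k)
  have ha := (der_modelRiem_0212 K P a b w).symm.trans (congrFun h0 _)
  have hb := (der_modelRiem_1212 K P a b w).symm.trans (congrFun h0 _)
  simp [hP0] at ha hb
  subst ha hb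
  have hw : w ≠ 0 := by
    rintro rfl
    refine hB0 ?_
    ext i j
    fin_cases i <;> fin_cases j <;> simp [nullAlg]
  have h1 := hBk 1 hk
  rw [show nullAlg 0 0 w = w • nullAlg 0 0 1 by simp [smul_nullAlg], smul_der] at h1
  exact (smul_eq_zero.1 h1).resolve_left hw

end CurvHom
end


/-! ### The rank count. -/

theorem mainTheorem7 {M : Type*} [TopologicalSpace M]
    [ChartedSpace (EuclideanSpace ℝ (Fin 3)) M] [IsManifold (𝓡 3) ∞ M]
    (g : CurvHom.Metric M CurvHom.etaNull)
    (hreg : CurvHom.IsFullyRegular g)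
    (hN : ∀ x : M, CurvHom.IsTypeNAt g x)
    (hCH : CurvHom.IsCurvatureHomogeneous g 0)
    (k : ℕ) (hps : CurvHom.HasPseudoStabilization g k) :
    ∃ m : ℤ, CurvHom.HasOrder g m ∧ m ≤ 3 := by
  -- From s_k > s_q ≥ 0, the group G_k has positive dimension; this is all that is used of
  -- pseudo-stabilization besides k ≥ 1.
  obtain ⟨hk, -, q, s, s', hq, ⟨S, G, hS, rfl⟩, -, -, hs⟩ := hps
  refine ⟨(q : ℤ) - 1, ⟨q, hq, rfl⟩, ?_⟩
  by_contra! hlt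
  have hq5 : 5 ≤ q := by omega
  choose r hr using hreg
  -- Minimality of q ≥ 5 excludes equality between consecutive ranks up to r_4.
  have hne : ∀ j < 4, r j ≠ r (j + 1) := by
    intro j hj e
    have : q ≤ j + 1 := hq.2 (show CurvHom.RankStable g (j + 1) from ⟨r j, hr j, e ▸ hr (j + 1)⟩)
    omega
  -- On an empty manifold r_0 = 0 holds vacuously, which would give q = 0.
  obtain ⟨x⟩ : Nonempty M := by
    by_contra hM
    have : q ≤ 0 := hq.2 (show CurvHom.RankStable g 0 from fun E x => (hM ⟨x⟩).elim)
    omega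
  obtain ⟨E, K, P, hx, hE⟩ := CurvHom.exists_isAdapted hCH (hN x) hk hS (by omega)
  have hrk : ∀ p, ∀ y ∈ E.U, E.liftRankAt p y 1 = r p := fun p y hy =>
    CurvHom.liftRankAt_eq_of_hasRank (hr p) hy
  have hmono : ∀ j < 4, r j + 1 ≤ r (j + 1) := fun j hj =>
    lt_of_le_of_ne (by
      rw [← hrk j x hx, ← hrk (j + 1) x hx]
      exact CurvHom.MovingFrame.liftRankAt_one_mono CurvHom.etaNull_det hx (Nat.le_succ j))
      (hne j hj)
  have h0 : r 0 + 1 ≤ r 1 := hmono 0 (by norm_num)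
  have h1 : r 1 + 1 ≤ r 2 := hmono 1 (by norm_num)
  have h2 : r 2 + 1 ≤ r 3 := hmono 2 (by norm_num)
  have h3 : r 3 + 1 ≤ r 4 := hmono 3 (by norm_num)
  -- In the first case r_4 ≥ r_0 + 4 ≥ 6 contradicts r_4 ≤ 5; in the second r_4 ≥ r_1 + 3 ≥ 7
  -- contradicts r_4 ≤ 6. Constancy of the ranks allows the second count to be made at any point
  -- where B² + K/2 ≠ 0.
  by_cases hB : ∀ y ∈ E.U, E.connLow 1 0 2 y ^ 2 + K / 2 = 0
  · have h4 := hE.two_le_liftRankAt_one hx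
    have h5 := hE.liftRankAt_one_le_five (p := 4) hB hx
    rw [hrk _ x hx] at h4 h5
    omega
  · push Not at hB
    obtain ⟨y, hy, hy0⟩ := hB
    have h4 := hE.four_le_liftRankAt_one hy hy0
    have h5 := CurvHom.MovingFrame.liftRankAt_one_le_six (p := 4) hy
    rw [hrk _ y hy] at h4 h5
    omega
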